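/- **Setting.** Fix a first-order signature with function symbols, built-in constraint symbols (containing at least falsity $\bot$ and syntactic equality $\doteq$) and, disjoint from these, user-defined constraint symbols. A built-in (user-defined) constraint is a finite, possibly empty conjunction of built-in (user-defined) atoms; CHR$^\vee$ goals are given by $G ::= \top \mid c_u(\bar t)\mid c_b(\bar t)\mid G\wedge G\mid G\vee G$. A CHR$^\vee$ program is a finite set of rules $H_1\setminus H_2\Leftrightarrow G\mid B$ with user-defined constraints $H_1,H_2$, a built-in guard $G$ and a goal $B$ as body; its local variables are $\bar y_r=vars(B,G)\setminus vars(H_1,H_2)$. A constraint theory $CT$ is a (possibly infinite) set of axioms $\forall(\exists\bar x.\mathbb B\to\exists\bar x'.\mathbb B')$ with built-in constraints $\mathbb B,\mathbb B'$; $CT\models\varphi$ means that the universal closure of $\varphi$ is a consequence of $CT$ in intuitionistic first-order logic. We assume that $CT$ is complete, in the sense that for every built-in constraint $\mathbb B$ either $CT\models\exists\mathbb B$ or $CT\models\neg\exists\mathbb B$ (where $\exists$ is existential closure), and that $CT$ proves the equality axioms for $\doteq$ (equivalence relation, and congruence for function symbols and built-in constraint symbols). A state $\langle G;V\rangle$ is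 a goal with a set $V$ of (global) variables; a configuration is a finite disjunction $S_1\vee\dots\vee S_n$ of states ($n\ge 0$). *Goal equivalence* $\equiv_G$ is equivalence with respect to associativity and commutativity of $\wedge$, neutrality of $\top$ for $\wedge$, and distributivity of $\wedge$ over $\vee$. *State equivalence* $\equiv_e$ is the smallest equivalence relation such that, for user-defined constraints $U$ and built-in constraints $\mathbb B,\mathbb B'$: - $\langle G;V\rangle\equiv_e\langle G';V\rangle$ if $G\equiv_G G'$; - $\langle U\wedge x\doteq t\wedge\mathbb B;V\rangle\equiv_e\langle U[x/t]\wedge x\doteq t\wedge\mathbb B;V\rangle$; - $\langle U\wedge\mathbb B;V\rangle\equiv_e\langle U\wedge\mathbb B';V\rangle$ if $CT\models\exists\bar s.\mathbb B\leftrightarrow\exists\bar s'.\mathbb B'$, where $\bar s=vars(\mathbb B)\setminus(V\cup vars(U))$ and $\bar s'=vars(\mathbb B')\setminus(V\cup vars(U))$; - $\langle G;\{x\}\cup V\rangle\equiv_e\langle G;V\rangle$ if $x\notin vars(G)$; - $\langle G\wedge\bot;V\rangle\equiv_e\langle G'\wedge\bot;V'\rangle$. *Configuration equivalence* is the smallest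 equivalence relation for which $\vee$ is associative and commutative, $S\vee\bar T\equiv S'\vee\bar T$ if $S\equiv_e S'$, $\langle\bot;\emptyset\rangle\vee\bar T\equiv\bar T$, and $\langle G_1\vee G_2;V\rangle\vee\bar T\equiv\langle G_1;V\rangle\vee\langle G_2;V\rangle\vee\bar T$. A program $P$ defines a transition relation on equivalence classes of configurations: $$[\langle H_1\wedge H_2\wedge G\wedge\mathbb G;V\rangle\vee\bar T]\;\mapsto\;[\langle H_1\wedge G\wedge B\wedge\mathbb G;V\rangle\vee\bar T]$$ whenever $H_1\setminus H_2\Leftrightarrow G\mid B$ is a variant (by renaming of variables) of a rule of $P$ whose local variables do not occur in $\mathbb G$, $V$ or the head, and $CT\models\exists(G\wedge\mathbb B)$, where $\mathbb B$ is the built-in part of the goal $\mathbb G$ (its user-defined atoms being replaced by $\top$). Let $\bar{\mathcal C}_{P,CT}(S)=\{[\bar T] : [S]\mapsto^*[\bar T]\}$. Programs $P_1,P_2$ are *operationally $\mathcal C$-equivalent* under $CT$ if $\bar{\mathcal C}_{P_1,CT}(S)=\bar{\mathcal C}_{P_2,CT}(S)$ for every state $S$. **Translation to intuitionistic linear logic.**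 On goals: $c_u(\bar t)^L=c_u(\bar t)$, $c_b(\bar t)^L={!}c_b(\bar t)$, $\bot^L=\mathbf 0$, $\top^L=\mathbf 1$, $(G\wedge G')^L=G^L\otimes G'^L$, $(G\vee G')^L=G^L\oplus G'^L$. A rule $R=(H_1\setminus H_2\Leftrightarrow G\mid B)$ becomes $R^L={!}\forall\bigl(H_1^L\otimes H_2^L\otimes G^L\multimap H_1^L\otimes\exists\bar y_r.(B^L\otimes G^L)\bigr)$, and $\bigotimes P^L$ is the tensor product of the $R^L$, $R\in P$ ($\mathbf 1$ if $P=\emptyset$). $CT^L$ is the set consisting of the translations $\alpha^*$ of the axioms $\alpha$ of $CT$, where $(\cdot)^*$ is given by $p(\bar t)^*={!}p(\bar t)$, $\bot^*=\mathbf 0$, $\top^*=\mathbf 1$, $(A\wedge B)^*=A^*\otimes B^*$, $(A\vee B)^*=A^*\oplus B^*$, $(A\to B)^*={!}(A^*\multimap B^*)$, $(\forall x.A)^*={!}\forall x.A^*$, $(\exists x.A)^*=\exists x.A^*$, together with, for every $n$-ary user-defined symbol $c_u$ and $1\le j\le n$, the formula ${!}\forall(c_u(\dots,x_j,\dots)\otimes{!}(x_j\doteq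 y)\multimap c_u(\dots,y,\dots)\otimes{!}(x_j\doteq y))$. **Proposition.** Let $P_1,P_2$ be CHR$^\vee$ programs that are operationally $\mathcal C$-equivalent under $CT$. Then they are logically equivalent under $CT$: $$CT^L\vdash\Bigl(\bigotimes P_1^L\multimap\bigotimes P_2^L\Bigr)\mathbin{\&}\Bigl(\bigotimes P_2^L\multimap\bigotimes P_1^L\Bigr),$$ that is, this formula is derivable in the sequent calculus of first-order intuitionistic linear logic from finitely many members of $CT^L$. -/

import Mathlib

universe u v w

namespace CHR

open FirstOrder.Language (Term)

/-! ## Constraints, goals, rules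

Terms are Mathlib's first-order terms over the function symbols of `L`, with variables `0, 1, 2, …`.
Built-in constraint symbols are the relation symbols of `L`, together with syntactic equality and
falsity; `U n` is the type of user-defined constraint symbols of arity `n`. -/

/-- Terms over the variables `ℕ`. -/
abbrev Tm (L : FirstOrder.Language.{u, v}) := L.Term ℕ

/-- The substitution that replaces the variable `x` by `t`. -/
def single {L : FirstOrder.Language.{u, v}} (x : ℕ) (t : Tm L) : ℕ → Tm L :=
  Function.update Term.var x t

/-- Atomic built-in constraints (apart from falsity): `s ≐ t` and `c_b(t₁, …, tₙ)`. -/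
inductive BAtom (L : FirstOrder.Language.{u, v}) : Type (max u v)
  | eq (s t : Tm L) : BAtom L
  | rel {n : ℕ} (c : L.Relations n) (ts : Fin n → Tm L) : BAtom L

/-- Atomic user-defined constraints `c_u(t₁, …, tₙ)`. -/
inductive UAtom (L : FirstOrder.Language.{u, v}) (U : ℕ → Type w) : Type (max u w)
  | mk {n : ℕ} (c : U n) (ts : Fin n → Tm L) : UAtom L U

/-- Built-in constraints. -/
inductive BCon (L : FirstOrder.Language.{u, v}) : Type (max u v)
  | top : BCon L
  | bot : BCon L
  | atom (a : BAtom L) : BCon L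
  | and (B B' : BCon L) : BCon L

/-- User-defined constraints. -/
inductive UCon (L : FirstOrder.Language.{u, v}) (U : ℕ → Type w) : Type (max u w)
  | top : UCon L U
  | atom (a : UAtom L U) : UCon L U
  | and (C C' : UCon L U) : UCon L U

/-- Goals of CHR with disjunction. -/
inductive Goal (L : FirstOrder.Language.{u, v}) (U : ℕ → Type w) : Type (max u v w)
  | top : Goal L U
  | bot : Goal L U
  | batom (a : BAtom L) : Goal L U
  | uatom (a : UAtom L U) : Goal L U
  | and (G G' : Goal L U) : Goal L U
  | or (G G' : Goal L U) : Goal L U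

section Constraints

variable {L : FirstOrder.Language.{u, v}} {U : ℕ → Type w}

def BAtom.subst (σ : ℕ → Tm L) : BAtom L → BAtom L
  | .eq s t => .eq (s.subst σ) (t.subst σ)
  | .rel c ts => .rel c (fun i => (ts i).subst σ)

def BAtom.vars : BAtom L → Finset ℕ
  | .eq s t => s.varFinset ∪ t.varFinset
  | .rel _ ts => Finset.univ.biUnion (fun i => (ts i).varFinset)

def UAtom.subst (σ : ℕ → Tm L) : UAtom L U → UAtom L U
  | .mk c ts => .mk c (fun i => (ts i).subst σ)

def UAtom.vars : UAtom L U → Finset ℕ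
  | .mk _ ts => Finset.univ.biUnion (fun i => (ts i).varFinset)

def BCon.subst (σ : ℕ → Tm L) : BCon L → BCon L
  | .top => .top
  | .bot => .bot
  | .atom a => .atom (a.subst σ)
  | .and B B' => .and (B.subst σ) (B'.subst σ)

def BCon.vars : BCon L → Finset ℕ
  | .top => ∅
  | .bot => ∅
  | .atom a => a.vars
  | .and B B' => B.vars ∪ B'.vars

def UCon.subst (σ : ℕ → Tm L) : UCon L U → UCon L U
  | .top => .top
  | .atom a => .atom (a.subst σ)
  | .and C C' => .and (C.subst σ) (C'.subst σ)

def UCon.vars : UCon L U → Finset ℕ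
  | .top => ∅
  | .atom a => a.vars
  | .and C C' => C.vars ∪ C'.vars

def Goal.subst (σ : ℕ → Tm L) : Goal L U → Goal L U
  | .top => .top
  | .bot => .bot
  | .batom a => .batom (a.subst σ)
  | .uatom a => .uatom (a.subst σ)
  | .and G G' => .and (G.subst σ) (G'.subst σ)
  | .or G G' => .or (G.subst σ) (G'.subst σ)

def Goal.vars : Goal L U → Finset ℕ
  | .top => ∅
  | .bot => ∅
  | .batom a => a.vars
  | .uatom a => a.vars
  | .and G G' => G.vars ∪ G'.vars
  | .or G G' => G.vars ∪ G'.vars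

/-- A built-in constraint is a goal. -/
def BCon.toGoal : BCon L → Goal L U
  | .top => .top
  | .bot => .bot
  | .atom a => .batom a
  | .and B B' => .and B.toGoal B'.toGoal

/-- A user-defined constraint is a goal. -/
def UCon.toGoal : UCon L U → Goal L U
  | .top => .top
  | .atom a => .uatom a
  | .and C C' => .and C.toGoal C'.toGoal

end Constraints

/-- Goal equivalence: the congruence generated by associativity and commutativity of `∧`, neutrality
of `⊤` for `∧`, and distributivity of `∧` over `∨`. -/
inductive GoalEquiv {L : FirstOrder.Language.{u, v}} {U : ℕ → Type w} : Goal L U → Goal L U → Prop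
  | refl (G) : GoalEquiv G G
  | symm {G G'} : GoalEquiv G G' → GoalEquiv G' G
  | trans {G G' G''} : GoalEquiv G G' → GoalEquiv G' G'' → GoalEquiv G G''
  | and_congr {G₁ G₁' G₂ G₂'} : GoalEquiv G₁ G₁' → GoalEquiv G₂ G₂' →
      GoalEquiv (.and G₁ G₂) (.and G₁' G₂')
  | or_congr {G₁ G₁' G₂ G₂'} : GoalEquiv G₁ G₁' → GoalEquiv G₂ G₂' →
      GoalEquiv (.or G₁ G₂) (.or G₁' G₂')
  | and_assoc (G₁ G₂ G₃) : GoalEquiv (.and (.and G₁ G₂) G₃) (.and G₁ (.and G₂ G₃))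
  | and_comm (G₁ G₂) : GoalEquiv (.and G₁ G₂) (.and G₂ G₁)
  | and_top (G) : GoalEquiv (.and G .top) G
  | and_or (G₁ G₂ G₃) : GoalEquiv (.and G₁ (.or G₂ G₃)) (.or (.and G₁ G₂) (.and G₁ G₃))

/-- A rule `H₁ \ H₂ ⇔ G | B` of CHR with disjunction. -/
structure Rule (L : FirstOrder.Language.{u, v}) (U : ℕ → Type w) : Type (max u v w) where
  /-- the kept head -/
  H₁ : UCon L U
  /-- the removed head -/
  H₂ : UCon L U
  /-- the guard -/
  G : BCon L
  /-- the body -/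
  B : Goal L U

/-- A program is a finite set of rules. -/
abbrev Program (L : FirstOrder.Language.{u, v}) (U : ℕ → Type w) := Finset (Rule L U)

section Rules

variable {L : FirstOrder.Language.{u, v}} {U : ℕ → Type w}

/-- The variables of the head. -/
def Rule.headVars (R : Rule L U) : Finset ℕ := R.H₁.vars ∪ R.H₂.vars

def Rule.vars (R : Rule L U) : Finset ℕ := R.headVars ∪ R.G.vars ∪ R.B.vars

/-- The local variables of a rule: those of the body and the guard that are not in the head. -/
def Rule.localVars (R : Rule L U) : Finset ℕ := (R.B.vars ∪ R.G.vars) \ R.headVars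

def Rule.subst (σ : ℕ → Tm L) (R : Rule L U) : Rule L U :=
  ⟨R.H₁.subst σ, R.H₂.subst σ, R.G.subst σ, R.B.subst σ⟩

/-- `R'` is a variant of `R`: it arises by renaming the variables of `R` to pairwise distinct
variables. -/
def Rule.IsVariant (R R' : Rule L U) : Prop :=
  ∃ ρ : ℕ → ℕ, Set.InjOn ρ (R.vars : Set ℕ) ∧ R' = R.subst (fun x => Term.var (ρ x))

end Rules

/-! ## Intuitionistic first-order logic and constraint theories

Formulas use de Bruijn indices: a quantifier binds the variable `0` of its scope, and the variable
`n + 1` in the scope is the variable `n` outside. -/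

/-- Lifting of a substitution under a quantifier. -/
def lift {L : FirstOrder.Language.{u, v}} (σ : ℕ → Tm L) : ℕ → Tm L
  | 0 => Term.var 0
  | n + 1 => (σ n).subst (fun k => Term.var (k + 1))

/-- The substitution that makes room for a new bound variable. -/
def shiftSub {L : FirstOrder.Language.{u, v}} : ℕ → Tm L := fun n => Term.var (n + 1)

/-- The substitution that replaces the bound variable by `t`. -/
def instSub {L : FirstOrder.Language.{u, v}} (t : Tm L) : ℕ → Tm L
  | 0 => t
  | n + 1 => Term.var n

/-- The substitution that turns the free variable `x` into the bound variable. -/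
def bindSub {L : FirstOrder.Language.{u, v}} (x : ℕ) : ℕ → Tm L :=
  fun n => if n = x then Term.var 0 else Term.var (n + 1)

/-- Formulas of intuitionistic first-order logic over the built-in constraints. -/
inductive IForm (L : FirstOrder.Language.{u, v}) : Type (max u v)
  | atom (a : BAtom L) : IForm L
  | bot : IForm L
  | top : IForm L
  | and (A B : IForm L) : IForm L
  | or (A B : IForm L) : IForm L
  | imp (A B : IForm L) : IForm L
  | all (A : IForm L) : IForm L
  | ex (A : IForm L) : IForm L

section IntuitionisticLogic

variable {L : FirstOrder.Language.{u, v}} {U : ℕ → Type w}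

def IForm.subst : (ℕ → Tm L) → IForm L → IForm L
  | σ, .atom a => .atom (a.subst σ)
  | _, .bot => .bot
  | _, .top => .top
  | σ, .and A B => .and (A.subst σ) (B.subst σ)
  | σ, .or A B => .or (A.subst σ) (B.subst σ)
  | σ, .imp A B => .imp (A.subst σ) (B.subst σ)
  | σ, .all A => .all (A.subst (lift σ))
  | σ, .ex A => .ex (A.subst (lift σ))

def IForm.shift (A : IForm L) : IForm L := A.subst shiftSub

def IForm.inst (A : IForm L) (t : Tm L) : IForm L := A.subst (instSub t)

/-- `∀ x. A`, for a named variable `x`. -/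
def IForm.allVar (x : ℕ) (A : IForm L) : IForm L := .all (A.subst (bindSub x))

/-- `∃ x. A`, for a named variable `x`. -/
def IForm.exVar (x : ℕ) (A : IForm L) : IForm L := .ex (A.subst (bindSub x))

/-- `∀ x̄. A`, for a finite set `x̄` of variables. -/
def IForm.alls (s : Finset ℕ) (A : IForm L) : IForm L := (s.sort (· ≤ ·)).foldr IForm.allVar A

/-- `∃ x̄. A`, for a finite set `x̄` of variables. -/
def IForm.exs (s : Finset ℕ) (A : IForm L) : IForm L := (s.sort (· ≤ ·)).foldr IForm.exVar A

def IForm.iff (A B : IForm L) : IForm L := .and (.imp A B) (.imp B A)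

/-- Natural deduction for intuitionistic first-order logic: `IProv T Γ A` says that `A` is derivable
from the closed axioms `T` and the hypotheses `Γ`. -/
inductive IProv (T : Set (IForm L)) : List (IForm L) → IForm L → Prop
  | ax {Γ A} : A ∈ T → IProv T Γ A
  | hyp {Γ A} : A ∈ Γ → IProv T Γ A
  | topI {Γ} : IProv T Γ .top
  | botE {Γ A} : IProv T Γ .bot → IProv T Γ A
  | andI {Γ A B} : IProv T Γ A → IProv T Γ B → IProv T Γ (.and A B)
  | andE₁ {Γ A B} : IProv T Γ (.and A B) → IProv T Γ A
  | andE₂ {Γ A B} : IProv T Γ (.and A B) → IProv T Γ B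
  | orI₁ {Γ A B} : IProv T Γ A → IProv T Γ (.or A B)
  | orI₂ {Γ A B} : IProv T Γ B → IProv T Γ (.or A B)
  | orE {Γ A B C} : IProv T Γ (.or A B) → IProv T (A :: Γ) C → IProv T (B :: Γ) C → IProv T Γ C
  | impI {Γ A B} : IProv T (A :: Γ) B → IProv T Γ (.imp A B)
  | impE {Γ A B} : IProv T Γ (.imp A B) → IProv T Γ A → IProv T Γ B
  | allI {Γ A} : IProv T (Γ.map IForm.shift) A → IProv T Γ (.all A)
  | allE {Γ A} (t : Tm L) : IProv T Γ (.all A) → IProv T Γ (A.inst t)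
  | exI {Γ A} (t : Tm L) : IProv T Γ (A.inst t) → IProv T Γ (.ex A)
  | exE {Γ A C} : IProv T Γ (.ex A) → IProv T (A :: Γ.map IForm.shift) C.shift → IProv T Γ C

/-- A built-in constraint as a formula. -/
def BCon.toForm : BCon L → IForm L
  | .top => .top
  | .bot => .bot
  | .atom a => .atom a
  | .and B B' => .and B.toForm B'.toForm

end IntuitionisticLogic

/-- The data of a constraint-theory axiom `∀(∃ x̄. B → ∃ x̄'. B')`. -/
structure CTAxiom (L : FirstOrder.Language.{u, v}) : Type (max u v) where
  xs : Finset ℕ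
  B : BCon L
  xs' : Finset ℕ
  B' : BCon L

/-- A constraint theory is given by a (possibly infinite) set of axioms. -/
abbrev ConstraintTheory (L : FirstOrder.Language.{u, v}) := Set (CTAxiom L)

section ConstraintTheories

variable {L : FirstOrder.Language.{u, v}} {U : ℕ → Type w}

/-- The closed formula `∀(∃ x̄. B → ∃ x̄'. B')`. -/
def CTAxiom.toForm (a : CTAxiom L) : IForm L :=
  IForm.alls ((a.B.vars \ a.xs) ∪ (a.B'.vars \ a.xs'))
    (.imp (IForm.exs a.xs a.B.toForm) (IForm.exs a.xs' a.B'.toForm))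

/-- `CT ⊨ A`; free variables of `A` are read universally. -/
def Models (CT : ConstraintTheory L) (A : IForm L) : Prop :=
  IProv (CTAxiom.toForm '' CT) [] A

/-- `CT` treats `≐` as an equality: it proves that `≐` is an equivalence relation and a congruence
for the function symbols and the built-in constraint symbols. -/
structure HasEquality (CT : ConstraintTheory L) : Prop where
  refl (t : Tm L) : Models CT (.atom (.eq t t))
  symm (s t : Tm L) : Models CT (.imp (.atom (.eq s t)) (.atom (.eq t s)))
  trans (r s t : Tm L) :
    Models CT (.imp (.and (.atom (.eq r s)) (.atom (.eq s t))) (.atom (.eq r t)))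
  func {n : ℕ} (f : L.Functions n) (ts : Fin n → Tm L) (j : Fin n) (s : Tm L) :
    Models CT (.imp (.atom (.eq (ts j) s))
      (.atom (.eq (FirstOrder.Language.Term.func f ts) (Term.func f (Function.update ts j s)))))
  rel {n : ℕ} (c : L.Relations n) (ts : Fin n → Tm L) (j : Fin n) (s : Tm L) :
    Models CT (.imp (.and (.atom (.eq (ts j) s)) (.atom (.rel c ts)))
      (.atom (.rel c (Function.update ts j s))))

/-- Completeness of `CT` on constraints: every built-in constraint is provably satisfiable or
provably unsatisfiable. -/
def IsCompleteTheory (CT : ConstraintTheory L) : Prop :=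
  ∀ B : BCon L, Models CT (IForm.exs B.vars B.toForm) ∨
    Models CT (.imp (IForm.exs B.vars B.toForm) .bot)

end ConstraintTheories

/-! ## States, configurations and their equivalence -/

/-- A state `⟨G; V⟩` with goal `G` and global variables `V`. -/
structure State (L : FirstOrder.Language.{u, v}) (U : ℕ → Type w) : Type (max u v w) where
  goal : Goal L U
  globals : Set ℕ

/-- A configuration `S₁ ∨ … ∨ Sₙ`; the empty list is the empty configuration, and the disjunction of
two configurations is concatenation. -/
abbrev Config (L : FirstOrder.Language.{u, v}) (U : ℕ → Type w) := List (State L U)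

section Semantics

variable {L : FirstOrder.Language.{u, v}} {U : ℕ → Type w}

open Classical in
/-- The strictly local variables of the state `⟨C ∧ B; V⟩`. -/
noncomputable def strictlyLocal (C : UCon L U) (B : BCon L) (V : Set ℕ) : Finset ℕ :=
  (C.vars ∪ B.vars).filter (fun x => x ∉ V ∧ x ∉ C.vars)

/-- Equivalence of states. -/
inductive StateEquiv (CT : ConstraintTheory L) : State L U → State L U → Prop
  | refl (S) : StateEquiv CT S S
  | symm {S T} : StateEquiv CT S T → StateEquiv CT T S
  | trans {S T R} : StateEquiv CT S T → StateEquiv CT T R → StateEquiv CT S R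
  /-- goal transformation -/
  | goal {G G' : Goal L U} (V : Set ℕ) : GoalEquiv G G' → StateEquiv CT ⟨G, V⟩ ⟨G', V⟩
  /-- equality as substitution -/
  | eqSubst (C : UCon L U) (x : ℕ) (t : Tm L) (B : BCon L) (V : Set ℕ) :
      StateEquiv CT
        ⟨.and (.and C.toGoal (.batom (.eq (Term.var x) t))) B.toGoal, V⟩
        ⟨.and (.and (C.subst (single x t)).toGoal (.batom (.eq (Term.var x) t))) B.toGoal, V⟩
  /-- application of the constraint theory -/
  | appCT (C : UCon L U) (B B' : BCon L) (V : Set ℕ) :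
      Models CT (IForm.iff (IForm.exs (strictlyLocal C B V) B.toForm)
        (IForm.exs (strictlyLocal C B' V) B'.toForm)) →
      StateEquiv CT ⟨.and C.toGoal B.toGoal, V⟩ ⟨.and C.toGoal B'.toGoal, V⟩
  /-- neutrality of redundant global variables -/
  | global (G : Goal L U) (x : ℕ) (V : Set ℕ) : x ∉ G.vars →
      StateEquiv CT ⟨G, {x} ∪ V⟩ ⟨G, V⟩
  /-- equivalence of failed states -/
  | fail (G G' : Goal L U) (V V' : Set ℕ) :
      StateEquiv CT ⟨.and G .bot, V⟩ ⟨.and G' .bot, V'⟩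

/-- The default failed state `⟨⊤ ∧ ⊥; ∅⟩`. -/
def failedState : State L U := ⟨.and .top .bot, ∅⟩

/-- Equivalence of configurations. -/
inductive ConfigEquiv (CT : ConstraintTheory L) : Config L U → Config L U → Prop
  | refl (S) : ConfigEquiv CT S S
  | symm {S T} : ConfigEquiv CT S T → ConfigEquiv CT T S
  | trans {S T R} : ConfigEquiv CT S T → ConfigEquiv CT T R → ConfigEquiv CT S R
  /-- associativity and commutativity of the disjunction: the order of the states is irrelevant -/
  | perm {S T : Config L U} : S.Perm T → ConfigEquiv CT S T
  /-- state equivalence -/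
  | state {S S' : State L U} (T : Config L U) : StateEquiv CT S S' →
      ConfigEquiv CT (S :: T) (S' :: T)
  /-- neutrality of failed states -/
  | fail (T : Config L U) : ConfigEquiv CT (failedState :: T) T
  /-- split -/
  | split (G₁ G₂ : Goal L U) (V : Set ℕ) (T : Config L U) :
      ConfigEquiv CT (⟨.or G₁ G₂, V⟩ :: T) (⟨G₁, V⟩ :: ⟨G₂, V⟩ :: T)

/-- Configurations up to equivalence. -/
def configSetoid (U : ℕ → Type w) (CT : ConstraintTheory L) : Setoid (Config L U) where
  r := ConfigEquiv CT
  iseqv := ⟨ConfigEquiv.refl, ConfigEquiv.symm, ConfigEquiv.trans⟩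

/-- Equivalence classes of configurations. -/
abbrev ConfigClass (U : ℕ → Type w) (CT : ConstraintTheory L) := Quotient (configSetoid U CT)

/-- The equivalence class of a configuration. -/
def Config.cls (CT : ConstraintTheory L) (S : Config L U) : ConfigClass U CT :=
  Quotient.mk (configSetoid U CT) S

/-! ## Operational semantics -/

/-- The built-in part of a goal. For a goal `C ∧ B` without disjunctions, this is its built-in
store `B`. -/
def Goal.builtin : Goal L U → IForm L
  | .top => .top
  | .bot => .bot
  | .batom a => .atom a
  | .uatom _ => .top
  | .and G G' => .and G.builtin G'.builtin
  | .or G G' => .or G.builtin G'.builtin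

/-- The transition relation on equivalence classes of configurations: a variant `R` of a rule of the
program is applied, the local variables of `R` being distinct from all variables of the remaining
goal `G` and from the global variables (and, by definition, from those of the head of `R`). -/
inductive Step (CT : ConstraintTheory L) (P : Program L U) :
    ConfigClass U CT → ConfigClass U CT → Prop
  | apply (R₀ R : Rule L U) (G : Goal L U) (V : Set ℕ) (T : Config L U) :
      R₀ ∈ P → R₀.IsVariant R →
      (∀ y ∈ R.localVars, y ∉ G.vars ∧ y ∉ V) →
      Models CT (IForm.exs (R.G.vars ∪ G.vars) (.and R.G.toForm G.builtin)) →
      Step CT P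
        (Config.cls CT
          (⟨.and (.and (.and R.H₁.toGoal R.H₂.toGoal) R.G.toGoal) G, V⟩ :: T))
        (Config.cls CT
          (⟨.and (.and (.and R.H₁.toGoal R.G.toGoal) R.B) G, V⟩ :: T))

/-- The computable configurations of a state. -/
def computable (CT : ConstraintTheory L) (P : Program L U) (S : State L U) :
    Set (ConfigClass U CT) :=
  {T | Relation.ReflTransGen (Step CT P) (Config.cls CT [S]) T}

/-- Operational `C`-equivalence under `CT`: the same computable configurations from every state. -/
def OperationallyCEquivalent (CT : ConstraintTheory L) (P₁ P₂ : Program L U) : Prop :=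
  ∀ S : State L U, computable CT P₁ S = computable CT P₂ S

end Semantics

/-! ## Intuitionistic linear logic -/

/-- Formulas of intuitionistic first-order linear logic, with de Bruijn indices. -/
inductive LForm (L : FirstOrder.Language.{u, v}) (U : ℕ → Type w) : Type (max u v w)
  | batom (a : BAtom L) : LForm L U
  | uatom (a : UAtom L U) : LForm L U
  | one : LForm L U
  | zero : LForm L U
  | top : LForm L U
  | tensor (α β : LForm L U) : LForm L U
  | lolli (α β : LForm L U) : LForm L U
  | with (α β : LForm L U) : LForm L U
  | plus (α β : LForm L U) : LForm L U
  | bang (α : LForm L U) : LForm L U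
  | all (α : LForm L U) : LForm L U
  | ex (α : LForm L U) : LForm L U

section LinearLogic

variable {L : FirstOrder.Language.{u, v}} {U : ℕ → Type w}

def LForm.subst : (ℕ → Tm L) → LForm L U → LForm L U
  | σ, .batom a => .batom (a.subst σ)
  | σ, .uatom a => .uatom (a.subst σ)
  | _, .one => .one
  | _, .zero => .zero
  | _, .top => .top
  | σ, .tensor α β => .tensor (α.subst σ) (β.subst σ)
  | σ, .lolli α β => .lolli (α.subst σ) (β.subst σ)
  | σ, .with α β => .with (α.subst σ) (β.subst σ)
  | σ, .plus α β => .plus (α.subst σ) (β.subst σ)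
  | σ, .bang α => .bang (α.subst σ)
  | σ, .all α => .all (α.subst (lift σ))
  | σ, .ex α => .ex (α.subst (lift σ))

def LForm.shift (α : LForm L U) : LForm L U := α.subst shiftSub

def LForm.inst (α : LForm L U) (t : Tm L) : LForm L U := α.subst (instSub t)

/-- `∀ x. α`, for a named variable `x`. -/
def LForm.allVar (x : ℕ) (α : LForm L U) : LForm L U := .all (α.subst (bindSub x))

/-- `∃ x. α`, for a named variable `x`. -/
def LForm.exVar (x : ℕ) (α : LForm L U) : LForm L U := .ex (α.subst (bindSub x))

/-- `∀ x̄. α`, for a finite set `x̄` of variables. -/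
def LForm.alls (s : Finset ℕ) (α : LForm L U) : LForm L U := (s.sort (· ≤ ·)).foldr LForm.allVar α

/-- `∃ x̄. α`, for a finite set `x̄` of variables. -/
def LForm.exs (s : Finset ℕ) (α : LForm L U) : LForm L U := (s.sort (· ≤ ·)).foldr LForm.exVar α

/-- The sequent calculus of intuitionistic linear logic, without proper axioms. In the rules for
quantifiers, the eigenvariable is the bound variable itself, the other formulas being shifted. -/
inductive LProv : Multiset (LForm L U) → LForm L U → Prop
  | identity (α) : LProv {α} α
  | cut {Γ Δ α β} : LProv Γ α → LProv (α ::ₘ Δ) β → LProv (Γ + Δ) β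
  | tensorL {Γ α β γ} : LProv (α ::ₘ β ::ₘ Γ) γ → LProv (.tensor α β ::ₘ Γ) γ
  | tensorR {Γ Δ α β} : LProv Γ α → LProv Δ β → LProv (Γ + Δ) (.tensor α β)
  | oneL {Γ α} : LProv Γ α → LProv (.one ::ₘ Γ) α
  | oneR : LProv 0 .one
  | lolliL {Γ Δ α β γ} : LProv Γ α → LProv (β ::ₘ Δ) γ → LProv (.lolli α β ::ₘ (Γ + Δ)) γ
  | lolliR {Γ α β} : LProv (α ::ₘ Γ) β → LProv Γ (.lolli α β)
  | bangR {Γ : Multiset (LForm L U)} {α} :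
      LProv (Γ.map LForm.bang) α → LProv (Γ.map LForm.bang) (.bang α)
  | dereliction {Γ α β} : LProv (α ::ₘ Γ) β → LProv (.bang α ::ₘ Γ) β
  | contraction {Γ α β} : LProv (.bang α ::ₘ .bang α ::ₘ Γ) β → LProv (.bang α ::ₘ Γ) β
  | weakening {Γ α β} : LProv Γ β → LProv (.bang α ::ₘ Γ) β
  | withL₁ {Γ α β γ} : LProv (α ::ₘ Γ) γ → LProv (.with α β ::ₘ Γ) γ
  | withL₂ {Γ α β γ} : LProv (β ::ₘ Γ) γ → LProv (.with α β ::ₘ Γ) γ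
  | withR {Γ α β} : LProv Γ α → LProv Γ β → LProv Γ (.with α β)
  | topR {Γ} : LProv Γ .top
  | plusL {Γ α β γ} : LProv (α ::ₘ Γ) γ → LProv (β ::ₘ Γ) γ → LProv (.plus α β ::ₘ Γ) γ
  | plusR₁ {Γ α β} : LProv Γ α → LProv Γ (.plus α β)
  | plusR₂ {Γ α β} : LProv Γ β → LProv Γ (.plus α β)
  | zeroL (α) : LProv {.zero} α
  | allL {Γ α β} (t : Tm L) : LProv (α.inst t ::ₘ Γ) β → LProv (.all α ::ₘ Γ) β
  | allR {Γ : Multiset (LForm L U)} {β} : LProv (Γ.map LForm.shift) β → LProv Γ (.all β)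
  | exL {Γ : Multiset (LForm L U)} {α β} :
      LProv (α ::ₘ Γ.map LForm.shift) β.shift → LProv (.ex α ::ₘ Γ) β
  | exR {Γ β} (t : Tm L) : LProv Γ (β.inst t) → LProv Γ (.ex β)

/-- `Θ ⊢ α` for a possibly infinite set `Θ` of formulas: some finite multiset of members of `Θ`
proves `α`. -/
def LEntails (Θ : Set (LForm L U)) (α : LForm L U) : Prop :=
  ∃ Γ : Multiset (LForm L U), (∀ γ ∈ Γ, γ ∈ Θ) ∧ LProv Γ α

/-! ## Translation to linear logic -/

/-- The translation of intuitionistic logic into intuitionistic linear logic. -/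
def IForm.star : IForm L → LForm L U
  | .atom a => .bang (.batom a)
  | .bot => .zero
  | .top => .one
  | .and A B => .tensor A.star B.star
  | .or A B => .plus A.star B.star
  | .imp A B => .bang (.lolli A.star B.star)
  | .all A => .bang (.all A.star)
  | .ex A => .ex A.star

/-- The linear-logic reading of goals. -/
def Goal.toL : Goal L U → LForm L U
  | .top => .one
  | .bot => .zero
  | .batom a => .bang (.batom a)
  | .uatom a => .uatom a
  | .and G G' => .tensor G.toL G'.toL
  | .or G G' => .plus G.toL G'.toL

/-- `!∀(c(x₁,…,xⱼ,…,xₙ) ⊗ !(xⱼ ≐ y) ⊸ c(x₁,…,y,…,xₙ) ⊗ !(xⱼ ≐ y))`, where `x₁, …, xₙ, y` are the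
variables `0, …, n - 1, n`. -/
def userCongr {n : ℕ} (c : U n) (j : Fin n) : LForm L U :=
  let xs : Fin n → Tm L := fun i => Term.var (i : ℕ)
  let y : Tm L := Term.var n
  let e : LForm L U := .bang (.batom (.eq (xs j) y))
  .bang (LForm.alls (Finset.range (n + 1))
    (.lolli (.tensor (.uatom (.mk c xs)) e)
      (.tensor (.uatom (.mk c (Function.update xs j y))) e)))

/-- The linear-logic reading of a constraint theory. -/
def theoryL (U : ℕ → Type w) (CT : ConstraintTheory L) : Set (LForm L U) :=
  {α | ∃ a ∈ CT, α = a.toForm.star} ∪ {α | ∃ (n : ℕ) (c : U n) (j : Fin n), α = userCongr c j}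

/-- The linear-logic reading of a rule, `!∀(H₁ ⊗ H₂ ⊗ G ⊸ H₁ ⊗ ∃ ȳ. (B ⊗ G))`, where `ȳ` are the
local variables of the rule. The free variables of the implication are those of the head and of the
guard. -/
def Rule.toL (R : Rule L U) : LForm L U :=
  .bang (LForm.alls (R.headVars ∪ R.G.vars)
    (.lolli (.tensor (.tensor R.H₁.toGoal.toL R.H₂.toGoal.toL) R.G.toGoal.toL)
      (.tensor R.H₁.toGoal.toL
        (LForm.exs R.localVars (.tensor R.B.toL R.G.toGoal.toL)))))

/-- The tensor product of the linear-logic readings of the rules of a program. -/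
noncomputable def programL (P : Program L U) : LForm L U :=
  (P.toList.map Rule.toL).foldr LForm.tensor .one

/-- `(α ⊸ β) & (β ⊸ α)`. -/
def LForm.equiv (α β : LForm L U) : LForm L U := .with (.lolli α β) (.lolli β α)

/-- Logical equivalence of programs under `CT`. -/
def LogicallyEquivalent (CT : ConstraintTheory L) (P₁ P₂ : Program L U) : Prop :=
  LEntails (theoryL U CT) ((programL P₁).equiv (programL P₂))

end LinearLogic

end CHR

namespace CHR

open FirstOrder.Language (Term)

/-! ### Substitution, named quantifiers and supports -/

section Substitution

variable {L : FirstOrder.Language.{u, v}} {U : ℕ → Type w}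

/-! By symmetry it suffices to derive each rule `R` of `P₂` from `CT^L` and the rules of `P₁`. Let
`R` be `H₁ \ H₂ ⇔ G | B` and start from the state consisting of its own head and guard, with the
head variables global.

If `CT` proves `G` unsatisfiable, then `G^L` yields `0` and the implication expressed by `R` holds
trivially (`Rule.derives_matrix_of_unsatisfiable`). Otherwise completeness makes `G` satisfiable, so
`P₂` applies `R` to this state in one step. By operational equivalence `P₁` computes the same
configuration, perhaps along a quite different path.

The bridge back to logic is soundness (`computable_derives`): a state, with its local variables
existentially quantified, linearly entails every configuration computed from it, configurations
being read as `⊕` of states. For the chosen state and result this entailment unfolds to the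
implication expressed by `R` (`Rule.derives_matrix_of_computable`); generalisation and promotion
then give `R^L`, and the translated rules of `P₁` may be replaced by the single repeatable resource
`⨂ P₁^L` (`Derives.of_union`).

Soundness has two ingredients. Equivalent configurations have interderivable readings
(`StateEquiv.interderivable`, `ConfigEquiv.interderivable`): this uses the embedding of
intuitionistic logic (`IProv.derives`) for the constraint theory, and the congruence axioms for
user-defined symbols for equality as substitution. A rule application is an instance of the rule's
implication (`Derives.apply_rule`), the freshness of its local variables being the eigenvariable
condition for opening the existential in its conclusion. -/

theorem term_subst_var (t : Tm L) : t.subst Term.var = t := by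
  induction t with
  | var => rfl
  | func f ts ih => simp only [Term.subst, ih]

theorem term_subst_subst (t : Tm L) (σ τ : ℕ → Tm L) :
    (t.subst σ).subst τ = t.subst (fun n => (σ n).subst τ) := by
  induction t with
  | var => rfl
  | func f ts ih => simp only [Term.subst, ih]

theorem term_subst_congr {t : Tm L} {σ τ : ℕ → Tm L} (h : ∀ x ∈ t.varFinset, σ x = τ x) :
    t.subst σ = t.subst τ := by
  induction t with
  | var n => exact h n (by simp [Term.varFinset])
  | func f ts ih =>
    simp only [Term.subst]
    congr 1
    funext i
    exact ih i fun x hx => h x (by simpa [Term.varFinset] using ⟨i, hx⟩)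

theorem term_varFinset_rename (t : Tm L) (ρ : ℕ → ℕ) :
    (t.subst fun x => Term.var (ρ x)).varFinset = t.varFinset.image ρ := by
  induction t with
  | var n => simp [Term.subst, Term.varFinset]
  | func f ts ih =>
    ext x
    simp only [Term.subst, Term.varFinset, ih, Finset.mem_biUnion, Finset.mem_image]
    grind

theorem BAtom.subst_var (a : BAtom L) : a.subst Term.var = a := by
  cases a <;> simp [BAtom.subst, term_subst_var]

theorem BAtom.subst_subst (a : BAtom L) (σ τ : ℕ → Tm L) :
    (a.subst σ).subst τ = a.subst (fun n => (σ n).subst τ) := by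
  cases a <;> simp [BAtom.subst, term_subst_subst]

theorem BAtom.subst_congr {a : BAtom L} {σ τ : ℕ → Tm L} (h : ∀ x ∈ a.vars, σ x = τ x) :
    a.subst σ = a.subst τ := by
  cases a with
  | eq s t =>
    simp only [BAtom.subst]
    rw [term_subst_congr (t := s) fun x hx => h x (by simp [BAtom.vars, hx]),
      term_subst_congr (t := t) fun x hx => h x (by simp [BAtom.vars, hx])]
  | rel c ts =>
    simp only [BAtom.subst]
    congr 1
    funext i
    exact term_subst_congr fun x hx => h x (by simpa [BAtom.vars] using ⟨i, hx⟩)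

theorem BAtom.vars_rename (a : BAtom L) (ρ : ℕ → ℕ) :
    (a.subst fun x => Term.var (ρ x)).vars = a.vars.image ρ := by
  cases a with
  | eq s t => simp [BAtom.subst, BAtom.vars, term_varFinset_rename, Finset.image_union]
  | rel c ts =>
    ext x
    simp only [BAtom.subst, BAtom.vars, term_varFinset_rename, Finset.mem_biUnion, Finset.mem_image]
    grind

theorem UAtom.subst_var (a : UAtom L U) : a.subst Term.var = a := by
  cases a; simp [UAtom.subst, term_subst_var]

theorem UAtom.subst_subst (a : UAtom L U) (σ τ : ℕ → Tm L) :
    (a.subst σ).subst τ = a.subst (fun n => (σ n).subst τ) := by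
  cases a; simp [UAtom.subst, term_subst_subst]

theorem UAtom.subst_congr {a : UAtom L U} {σ τ : ℕ → Tm L} (h : ∀ x ∈ a.vars, σ x = τ x) :
    a.subst σ = a.subst τ := by
  cases a with
  | mk c ts =>
    simp only [UAtom.subst]
    congr 1
    funext i
    exact term_subst_congr fun x hx => h x (by simpa [UAtom.vars] using ⟨i, hx⟩)

theorem UAtom.vars_rename (a : UAtom L U) (ρ : ℕ → ℕ) :
    (a.subst fun x => Term.var (ρ x)).vars = a.vars.image ρ := by
  cases a with
  | mk c ts =>
    ext x
    simp only [UAtom.subst, UAtom.vars, term_varFinset_rename, Finset.mem_biUnion, Finset.mem_image]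
    grind

theorem BCon.subst_var (B : BCon L) : B.subst Term.var = B := by
  induction B <;> simp [BCon.subst, BAtom.subst_var, *]

theorem UCon.subst_var (C : UCon L U) : C.subst Term.var = C := by
  induction C <;> simp [UCon.subst, UAtom.subst_var, *]

theorem Goal.subst_var (G : Goal L U) : G.subst Term.var = G := by
  induction G <;> simp [Goal.subst, UAtom.subst_var, BAtom.subst_var, *]

theorem BCon.subst_congr {B : BCon L} {σ τ : ℕ → Tm L} (h : ∀ x ∈ B.vars, σ x = τ x) :
    B.subst σ = B.subst τ := by
  induction B with
  | top => rfl
  | bot => rfl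
  | atom a => exact congrArg BCon.atom (BAtom.subst_congr h)
  | and B B' ih ih' =>
    simp only [BCon.vars, Finset.mem_union] at h
    simp only [BCon.subst, ih fun x hx => h x (.inl hx), ih' fun x hx => h x (.inr hx)]

theorem UCon.subst_congr {C : UCon L U} {σ τ : ℕ → Tm L} (h : ∀ x ∈ C.vars, σ x = τ x) :
    C.subst σ = C.subst τ := by
  induction C with
  | top => rfl
  | atom a => exact congrArg UCon.atom (UAtom.subst_congr h)
  | and B B' ih ih' =>
    simp only [UCon.vars, Finset.mem_union] at h
    simp only [UCon.subst, ih fun x hx => h x (.inl hx), ih' fun x hx => h x (.inr hx)]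

theorem Goal.subst_congr {G : Goal L U} {σ τ : ℕ → Tm L} (h : ∀ x ∈ G.vars, σ x = τ x) :
    G.subst σ = G.subst τ := by
  induction G with
  | top => rfl
  | bot => rfl
  | batom a => exact congrArg Goal.batom (BAtom.subst_congr h)
  | uatom a => exact congrArg Goal.uatom (UAtom.subst_congr h)
  | and B B' ih ih' | or B B' ih ih' =>
    simp only [Goal.vars, Finset.mem_union] at h
    simp only [Goal.subst, ih fun x hx => h x (.inl hx), ih' fun x hx => h x (.inr hx)]

theorem Rule.subst_congr {R : Rule L U} {σ τ : ℕ → Tm L} (h : ∀ x ∈ R.vars, σ x = τ x) :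
    R.subst σ = R.subst τ := by
  simp only [Rule.vars, Rule.headVars, Finset.mem_union] at h
  simp only [Rule.subst, UCon.subst_congr fun x hx => h x (.inl (.inl (.inl hx))),
    UCon.subst_congr fun x hx => h x (.inl (.inl (.inr hx))),
    BCon.subst_congr fun x hx => h x (.inl (.inr hx)),
    Goal.subst_congr fun x hx => h x (.inr hx)]

theorem BCon.vars_rename (B : BCon L) (ρ : ℕ → ℕ) :
    (B.subst fun x => Term.var (ρ x)).vars = B.vars.image ρ := by
  induction B <;> simp [BCon.subst, BCon.vars, BAtom.vars_rename, Finset.image_union, *]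

theorem UCon.vars_rename (C : UCon L U) (ρ : ℕ → ℕ) :
    (C.subst fun x => Term.var (ρ x)).vars = C.vars.image ρ := by
  induction C <;> simp [UCon.subst, UCon.vars, UAtom.vars_rename, Finset.image_union, *]

theorem Goal.vars_rename (G : Goal L U) (ρ : ℕ → ℕ) :
    (G.subst fun x => Term.var (ρ x)).vars = G.vars.image ρ := by
  induction G <;>
    simp [Goal.subst, Goal.vars, UAtom.vars_rename, BAtom.vars_rename, Finset.image_union, *]

theorem BCon.vars_toGoal (B : BCon L) : (B.toGoal : Goal L U).vars = B.vars := by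
  induction B <;> simp [BCon.toGoal, BCon.vars, Goal.vars, *]

theorem UCon.vars_toGoal (C : UCon L U) : C.toGoal.vars = C.vars := by
  induction C <;> simp [UCon.toGoal, UCon.vars, Goal.vars, *]

theorem BCon.toGoal_subst (B : BCon L) (σ : ℕ → Tm L) :
    ((B.subst σ).toGoal : Goal L U) = B.toGoal.subst σ := by
  induction B <;> simp [BCon.toGoal, BCon.subst, Goal.subst, *]

theorem UCon.toGoal_subst (C : UCon L U) (σ : ℕ → Tm L) :
    (C.subst σ).toGoal = C.toGoal.subst σ := by
  induction C <;> simp [UCon.toGoal, UCon.subst, Goal.subst, *]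

theorem Goal.toL_subst (G : Goal L U) (σ : ℕ → Tm L) : (G.subst σ).toL = G.toL.subst σ := by
  induction G <;> simp [Goal.toL, LForm.subst, Goal.subst, *]

theorem lift_var : lift (Term.var : ℕ → Tm L) = Term.var := by
  funext n
  cases n <;> rfl

theorem lift_comp (σ τ : ℕ → Tm L) :
    (fun n => (lift σ n).subst (lift τ)) = lift (fun n => (σ n).subst τ) := by
  funext n
  cases n with
  | zero => rfl
  | succ n =>
    simp only [lift, term_subst_subst]
    rfl

theorem LForm.subst_var (α : LForm L U) : α.subst Term.var = α := by
  induction α <;> simp [LForm.subst, lift_var, BAtom.subst_var, UAtom.subst_var, *]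

theorem LForm.subst_subst (α : LForm L U) (σ τ : ℕ → Tm L) :
    (α.subst σ).subst τ = α.subst (fun n => (σ n).subst τ) := by
  induction α generalizing σ τ <;>
    simp [LForm.subst, lift_comp, BAtom.subst_subst, UAtom.subst_subst, *]

theorem IForm.star_subst (A : IForm L) (σ : ℕ → Tm L) :
    ((A.subst σ).star : LForm L U) = A.star.subst σ := by
  induction A generalizing σ <;> simp [IForm.star, IForm.subst, LForm.subst, *]

theorem IForm.star_shift (A : IForm L) : (A.shift.star : LForm L U) = A.star.shift :=
  A.star_subst _

theorem LForm.shift_subst (α : LForm L U) (σ : ℕ → Tm L) :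
    α.shift.subst (lift σ) = (α.subst σ).shift := by
  simp only [LForm.shift, LForm.subst_subst]
  rfl

theorem inst_subst_fun (t : Tm L) (σ : ℕ → Tm L) :
    (fun n => (instSub t n).subst σ) = fun n => (lift σ n).subst (instSub (t.subst σ)) := by
  funext n
  cases n with
  | zero => rfl
  | succ n =>
    simp only [lift, term_subst_subst]
    exact (term_subst_var (σ n)).symm

theorem LForm.inst_subst (α : LForm L U) (t : Tm L) (σ : ℕ → Tm L) :
    (α.inst t).subst σ = (α.subst (lift σ)).inst (t.subst σ) := by
  simp only [LForm.inst, LForm.subst_subst, inst_subst_fun]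

/-- The bridge between named and de Bruijn quantifiers: binding `x` and then instantiating amounts
to updating the ambient substitution at `x`. -/
theorem LForm.bindSub_inst (α : LForm L U) (x : ℕ) (τ : ℕ → Tm L) (t : Tm L) :
    ((α.subst (bindSub x)).subst (lift τ)).inst t = α.subst (Function.update τ x t) := by
  simp only [LForm.inst, LForm.subst_subst]
  congr 1
  funext n
  by_cases h : n = x
  · subst h
    simp [bindSub, Term.subst, lift, instSub]
  · simp only [bindSub, h, if_false, Term.subst, lift, term_subst_subst, Function.update_of_ne h]
    exact term_subst_var (τ n)

/-- The effect of a substitution on `α` depends only on its values on `A`. -/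
def LForm.SupportedOn (α : LForm L U) (A : Set ℕ) : Prop :=
  ∀ ⦃σ τ : ℕ → Tm L⦄, (∀ x ∈ A, σ x = τ x) → α.subst σ = α.subst τ

theorem LForm.SupportedOn.mono {α : LForm L U} {A B : Set ℕ} (h : α.SupportedOn A) (hAB : A ⊆ B) :
    α.SupportedOn B :=
  fun _ _ hστ => h fun x hx => hστ x (hAB hx)

theorem LForm.SupportedOn.tensor {α β : LForm L U} {A : Set ℕ} (hα : α.SupportedOn A)
    (hβ : β.SupportedOn A) : (α.tensor β).SupportedOn A :=
  fun _ _ h => congrArg₂ LForm.tensor (hα h) (hβ h)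

theorem LForm.SupportedOn.lolli {α β : LForm L U} {A : Set ℕ} (hα : α.SupportedOn A)
    (hβ : β.SupportedOn A) : (α.lolli β).SupportedOn A :=
  fun _ _ h => congrArg₂ LForm.lolli (hα h) (hβ h)

theorem LForm.SupportedOn.plus {α β : LForm L U} {A : Set ℕ} (hα : α.SupportedOn A)
    (hβ : β.SupportedOn A) : (α.plus β).SupportedOn A :=
  fun _ _ h => congrArg₂ LForm.plus (hα h) (hβ h)

theorem LForm.SupportedOn.bang {α : LForm L U} {A : Set ℕ} (hα : α.SupportedOn A) :
    α.bang.SupportedOn A :=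
  fun _ _ h => congrArg LForm.bang (hα h)

/-- Empty support serves as the notion of closed formula; in particular such formulas are fixed by
shifting. -/
theorem LForm.SupportedOn.subst_eq_self {α : LForm L U} (h : α.SupportedOn ∅) (σ : ℕ → Tm L) :
    α.subst σ = α := by
  rw [h (τ := Term.var) (by simp), α.subst_var]

theorem LForm.SupportedOn.bindSub {α : LForm L U} {A : Set ℕ} (h : α.SupportedOn A) (x : ℕ)
    {σ τ : ℕ → Tm L} (hστ : ∀ y ∈ A \ {x}, σ y = τ y) :
    (α.subst (bindSub x)).subst (lift σ) = (α.subst (CHR.bindSub x)).subst (lift τ) := by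
  simp only [LForm.subst_subst]
  refine h fun y hy => ?_
  by_cases hyx : y = x
  · simp [CHR.bindSub, hyx, Term.subst, lift]
  · simp [CHR.bindSub, hyx, Term.subst, lift, hστ y ⟨hy, hyx⟩]

theorem LForm.SupportedOn.exVar {α : LForm L U} {A : Set ℕ} (h : α.SupportedOn A) (x : ℕ) :
    (α.exVar x).SupportedOn (A \ {x}) :=
  fun _ _ hστ => congrArg LForm.ex (h.bindSub x hστ)

theorem LForm.SupportedOn.allVar {α : LForm L U} {A : Set ℕ} (h : α.SupportedOn A) (x : ℕ) :
    (α.allVar x).SupportedOn (A \ {x}) :=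
  fun _ _ hστ => congrArg LForm.all (h.bindSub x hστ)

/-- Abstract in the quantifier `Q`, so that one induction over the prefix serves both `∃` and `∀`.
-/
theorem LForm.SupportedOn.foldr {α : LForm L U} {A : Set ℕ} {Q : ℕ → LForm L U → LForm L U}
    (hQ : ∀ x β B, LForm.SupportedOn β B → (Q x β).SupportedOn (B \ {x})) (h : α.SupportedOn A)
    (l : List ℕ) : (l.foldr Q α).SupportedOn (A \ {x | x ∈ l}) := by
  induction l with
  | nil => simpa using h
  | cons x l ih =>
    refine (hQ x _ _ ih).mono fun y hy => ?_
    simp only [Set.mem_sdiff, Set.mem_ofPred_eq, Set.mem_singleton_iff, List.mem_cons] at hy ⊢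
    tauto

theorem LForm.SupportedOn.exs {α : LForm L U} {A : Set ℕ} (h : α.SupportedOn A) (s : Finset ℕ) :
    (LForm.exs s α).SupportedOn (A \ s) :=
  (LForm.SupportedOn.foldr (fun x _ _ h => h.exVar x) h _).mono fun y hy => by simpa using hy

theorem LForm.SupportedOn.alls {α : LForm L U} {A : Set ℕ} (h : α.SupportedOn A) (s : Finset ℕ) :
    (LForm.alls s α).SupportedOn (A \ s) :=
  (LForm.SupportedOn.foldr (fun x _ _ h => h.allVar x) h _).mono fun y hy => by simpa using hy

theorem Goal.toL_supportedOn (G : Goal L U) : G.toL.SupportedOn G.vars := fun σ τ h => by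
  rw [← Goal.toL_subst, ← Goal.toL_subst, Goal.subst_congr h]

theorem LForm.SupportedOn.subst_rename {α : LForm L U} {A : Set ℕ} (h : α.SupportedOn A)
    (ρ : ℕ → ℕ) : (α.subst fun x => Term.var (ρ x)).SupportedOn (ρ '' A) := fun σ τ hστ => by
  simp only [LForm.subst_subst]
  exact h fun x hx => hστ _ (Set.mem_image_of_mem ρ hx)

theorem IForm.star_exVar (x : ℕ) (A : IForm L) :
    ((A.exVar x).star : LForm L U) = A.star.exVar x := by
  simp [IForm.exVar, LForm.exVar, IForm.star, IForm.star_subst]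

theorem IForm.star_exs (s : Finset ℕ) (A : IForm L) :
    ((IForm.exs s A).star : LForm L U) = LForm.exs s A.star := by
  unfold IForm.exs LForm.exs
  induction s.sort (· ≤ ·) with
  | nil => rfl
  | cons x l ih => simp only [List.foldr_cons, IForm.star_exVar, ih]

/-- The translation puts a `!` before every `∀`, so a translated prefix is not an instance of
`LForm.alls` and needs its own induction. -/
theorem IForm.star_alls_supportedOn {A : IForm L} {V : Set ℕ}
    (h : (A.star : LForm L U).SupportedOn V) (s : Finset ℕ) :
    ((IForm.alls s A).star : LForm L U).SupportedOn (V \ s) := by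
  have key : ∀ l : List ℕ,
      ((l.foldr IForm.allVar A).star : LForm L U).SupportedOn (V \ {x | x ∈ l}) := by
    intro l
    induction l with
    | nil => simpa using h
    | cons x l ih =>
      have := (ih.allVar x).bang
      simp only [List.foldr_cons, IForm.allVar, IForm.star, IForm.star_subst]
      refine this.mono fun y hy => ?_
      simp only [Set.mem_sdiff, Set.mem_ofPred_eq, Set.mem_singleton_iff, List.mem_cons] at hy ⊢
      tauto
  exact (key _).mono fun y hy => by simpa using hy

theorem BCon.star_toForm (B : BCon L) : (B.toForm.star : LForm L U) = B.toGoal.toL := by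
  induction B <;> simp [BCon.toForm, IForm.star, BCon.toGoal, Goal.toL, *]

/-- The outer prefix quantifies all variables that the two inner existentials leave free. -/
theorem CTAxiom.star_toForm_supportedOn (a : CTAxiom L) :
    (a.toForm.star : LForm L U).SupportedOn ∅ := by
  have key : ∀ (B : BCon L) (xs : Finset ℕ),
      ((IForm.exs xs B.toForm).star : LForm L U).SupportedOn ((B.vars \ xs : Finset ℕ) : Set ℕ) := by
    intro B xs
    rw [IForm.star_exs, BCon.star_toForm]
    refine (B.toGoal.toL_supportedOn.exs xs).mono ?_
    simp [BCon.vars_toGoal]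
  have h := (((key a.B a.xs).mono (B := ((a.B.vars \ a.xs) ∪ (a.B'.vars \ a.xs') : Finset ℕ))
      (by simp)).lolli ((key a.B' a.xs').mono (by simp))).bang
  exact (IForm.star_alls_supportedOn (A := .imp _ _) h _).mono (by simp)

theorem userCongr_supportedOn {n : ℕ} (c : U n) (j : Fin n) :
    (userCongr c j : LForm L U).SupportedOn ∅ := by
  have hv : ∀ ts : Fin n → Tm L,
      (∀ i, ((ts i).varFinset : Set ℕ) ⊆ (Finset.range (n + 1) : Finset ℕ)) →
      (LForm.uatom (.mk c ts) : LForm L U).SupportedOn (Finset.range (n + 1) : Finset ℕ) := by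
    intro ts h σ τ hστ
    refine congrArg LForm.uatom (UAtom.subst_congr fun x hx => hστ x ?_)
    simp only [UAtom.vars, Finset.mem_biUnion] at hx
    obtain ⟨i, -, hi⟩ := hx
    exact h i hi
  have he : (LForm.bang (.batom (.eq (Term.var (j : ℕ)) (Term.var n))) : LForm L U).SupportedOn
      (Finset.range (n + 1) : Finset ℕ) := by
    intro σ τ hστ
    simp only [LForm.subst, BAtom.subst, Term.subst]
    rw [hστ j (by simp), hστ n (by simp)]
  refine (LForm.SupportedOn.alls (((hv _ ?_).tensor he).lolli ((hv _ ?_).tensor he)) _).bang.mono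
    (by simp)
  · intro i
    simp [Term.varFinset]
  · intro i
    by_cases h : i = j
    · subst h
      simp [Term.varFinset]
    · simp [h, Term.varFinset]

/-- The induction must vary `σ`: in the eigenvariable rules it continues with `lift σ`, which fixes
the eigenvariable and commutes with shifting the context. -/
theorem LProv.subst {Γ : Multiset (LForm L U)} {α : LForm L U} (h : LProv Γ α) (σ : ℕ → Tm L) :
    LProv (Γ.map (LForm.subst σ)) (α.subst σ) := by
  have hbang : ∀ (Γ : Multiset (LForm L U)) (σ : ℕ → Tm L),
      (Γ.map LForm.bang).map (LForm.subst σ) = (Γ.map (LForm.subst σ)).map LForm.bang := by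
    intro Γ σ
    simp only [Multiset.map_map]
    rfl
  have hshift : ∀ (Γ : Multiset (LForm L U)) (σ : ℕ → Tm L),
      (Γ.map LForm.shift).map (LForm.subst (lift σ)) = (Γ.map (LForm.subst σ)).map LForm.shift := by
    intro Γ σ
    simp only [Multiset.map_map]
    exact Multiset.map_congr rfl fun α _ => α.shift_subst σ
  induction h generalizing σ with
  | identity α => simpa using LProv.identity _
  | cut _ _ ih₁ ih₂ =>
    rw [Multiset.map_add]
    exact .cut (ih₁ σ) (by simpa using ih₂ σ)
  | tensorL _ ih =>
    rw [Multiset.map_cons]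
    exact .tensorL (by simpa using ih σ)
  | tensorR _ _ ih₁ ih₂ =>
    rw [Multiset.map_add]
    exact .tensorR (ih₁ σ) (ih₂ σ)
  | oneL _ ih =>
    rw [Multiset.map_cons]
    exact .oneL (ih σ)
  | oneR => exact .oneR
  | lolliL _ _ ih₁ ih₂ =>
    rw [Multiset.map_cons, Multiset.map_add]
    exact .lolliL (ih₁ σ) (by simpa using ih₂ σ)
  | lolliR _ ih => exact .lolliR (by simpa using ih σ)
  | bangR _ ih =>
    have := ih σ
    rw [hbang] at this ⊢
    exact .bangR this
  | dereliction _ ih =>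
    rw [Multiset.map_cons]
    exact .dereliction (by simpa using ih σ)
  | contraction _ ih =>
    rw [Multiset.map_cons]
    exact .contraction (by simpa [LForm.subst] using ih σ)
  | weakening _ ih =>
    rw [Multiset.map_cons]
    exact .weakening (ih σ)
  | withL₁ _ ih =>
    rw [Multiset.map_cons]
    exact .withL₁ (by simpa using ih σ)
  | withL₂ _ ih =>
    rw [Multiset.map_cons]
    exact .withL₂ (by simpa using ih σ)
  | withR _ _ ih₁ ih₂ => exact .withR (ih₁ σ) (ih₂ σ)
  | topR => exact .topR
  | plusL _ _ ih₁ ih₂ =>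
    rw [Multiset.map_cons]
    exact .plusL (by simpa using ih₁ σ) (by simpa using ih₂ σ)
  | plusR₁ _ ih => exact .plusR₁ (ih σ)
  | plusR₂ _ ih => exact .plusR₂ (ih σ)
  | zeroL α => exact .zeroL _
  | allL t _ ih =>
    rw [Multiset.map_cons]
    refine .allL (t.subst σ) ?_
    simpa [LForm.inst_subst] using ih σ
  | allR _ ih => exact .allR (by simpa only [hshift] using ih (lift σ))
  | exL _ ih =>
    rw [Multiset.map_cons]
    refine .exL ?_
    simpa only [hshift, LForm.shift_subst, Multiset.map_cons] using ih (lift σ)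
  | exR t _ ih =>
    refine .exR (t.subst σ) ?_
    simpa only [LForm.inst_subst] using ih σ

end Substitution

end CHR

namespace CHR

open FirstOrder.Language (Term)

/-! ### Repeatable formulas and derivability from a theory -/

section Derivability

variable {L : FirstOrder.Language.{u, v}} {U : ℕ → Type w}

/-- Formulas that may be used repeatedly or not at all. -/
def LForm.Banged (α : LForm L U) : Prop := LProv {α} α.bang

theorem LForm.banged_bang (α : LForm L U) : α.bang.Banged := by
  have : LProv (({α} : Multiset (LForm L U)).map LForm.bang) α.bang := by
    simpa using LProv.identity α.bang
  simpa [LForm.Banged] using LProv.bangR this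

/-- Each `!γ` is cut against `γ ⊢ !γ`. This transfers the structural rules, stated for `!`, to
formulas that are repeatable without having `!` outermost. -/
theorem LProv.of_map_bang {Γ Δ : Multiset (LForm L U)} {β : LForm L U} (hΓ : ∀ γ ∈ Γ, γ.Banged)
    (h : LProv (Γ.map LForm.bang + Δ) β) : LProv (Γ + Δ) β := by
  induction Γ using Multiset.induction generalizing Δ with
  | empty => simpa using h
  | cons γ Γ ih =>
    have h' : LProv (Γ.map LForm.bang + γ.bang ::ₘ Δ) β := by
      simpa [Multiset.add_cons] using h
    have h₂ := ih (fun δ hδ => hΓ δ (Multiset.mem_cons_of_mem hδ)) h'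
    rw [Multiset.add_cons] at h₂
    simpa [add_assoc] using LProv.cut (hΓ γ (Multiset.mem_cons_self _ _)) h₂

theorem LProv.weaken_banged {Γ Δ : Multiset (LForm L U)} {β : LForm L U} (hΓ : ∀ γ ∈ Γ, γ.Banged)
    (h : LProv Δ β) : LProv (Γ + Δ) β := by
  refine LProv.of_map_bang hΓ ?_
  clear hΓ
  induction Γ using Multiset.induction with
  | empty => simpa using h
  | cons γ Γ ih => simpa using LProv.weakening (α := γ) ih

theorem LProv.dereliction_multiset {Γ Δ : Multiset (LForm L U)} {β : LForm L U}
    (h : LProv (Γ + Δ) β) : LProv (Γ.map LForm.bang + Δ) β := by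
  induction Γ using Multiset.induction generalizing Δ with
  | empty => simpa using h
  | cons γ Γ ih =>
    have := ih (Δ := γ ::ₘ Δ) (by simpa [Multiset.add_cons] using h)
    rw [Multiset.add_cons] at this
    simpa using LProv.dereliction this

theorem LProv.contract_bang {Γ Δ : Multiset (LForm L U)} {β : LForm L U}
    (h : LProv (Γ.map LForm.bang + Γ.map LForm.bang + Δ) β) :
    LProv (Γ.map LForm.bang + Δ) β := by
  induction Γ using Multiset.induction generalizing Δ with
  | empty => simpa using h
  | cons γ Γ ih =>
    have := ih (Δ := γ.bang ::ₘ γ.bang ::ₘ Δ)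
      (by simpa [Multiset.add_cons, Multiset.cons_add] using h)
    rw [Multiset.add_cons, Multiset.add_cons] at this
    simpa using LProv.contraction this

theorem LProv.contract_banged {Γ Δ : Multiset (LForm L U)} {β : LForm L U}
    (hΓ : ∀ γ ∈ Γ, γ.Banged) (h : LProv (Γ + Γ + Δ) β) : LProv (Γ + Δ) β := by
  refine LProv.of_map_bang hΓ (LProv.contract_bang ?_)
  rw [add_assoc]
  refine LProv.dereliction_multiset ?_
  rw [add_left_comm]
  refine LProv.dereliction_multiset ?_
  rwa [← add_assoc]

theorem LProv.promote {Γ : Multiset (LForm L U)} {β : LForm L U} (hΓ : ∀ γ ∈ Γ, γ.Banged)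
    (h : LProv Γ β) : LProv Γ β.bang := by
  have h₁ : LProv (Γ.map LForm.bang + 0) β := LProv.dereliction_multiset (by simpa using h)
  have h₂ := LProv.bangR (Γ := Γ) (by simpa using h₁)
  simpa using LProv.of_map_bang (Δ := 0) hΓ (by simpa using h₂)

/-- The calculus has the rule for `0` without side context. Extra formulas are absorbed one at a
time: `0` proves `γ ⊸ β`, which then consumes `γ`. -/
theorem LProv.zeroL_cons (Γ : Multiset (LForm L U)) (β : LForm L U) :
    LProv (.zero ::ₘ Γ) β := by
  induction Γ using Multiset.induction generalizing β with
  | empty => exact .zeroL β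
  | cons γ Γ ih =>
    have h₁ : LProv (LForm.lolli γ β ::ₘ ({γ} + 0)) β := .lolliL (.identity γ) (.identity β)
    have h₂ := LProv.cut (ih (.lolli γ β)) h₁
    convert h₂ using 1
    simp only [← Multiset.singleton_add]
    abel

theorem banged_zero : (LForm.zero : LForm L U).Banged := .zeroL _

theorem banged_one : (LForm.one : LForm L U).Banged :=
  .oneL (LProv.bangR (Γ := 0) .oneR)

theorem LForm.Banged.tensor {α β : LForm L U} (hα : α.Banged) (hβ : β.Banged) :
    (α.tensor β).Banged := by
  refine LProv.tensorL (Γ := 0) (LProv.promote ?_ ?_)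
  · simpa using ⟨hα, hβ⟩
  · exact LProv.tensorR (.identity α) (.identity β)

theorem LForm.Banged.plus {α β : LForm L U} (hα : α.Banged) (hβ : β.Banged) :
    (α.plus β).Banged := by
  refine LProv.plusL (Γ := 0) (LProv.promote ?_ ?_) (LProv.promote ?_ ?_)
  · simpa using hα
  · exact LProv.plusR₁ (.identity α)
  · simpa using hβ
  · exact LProv.plusR₂ (.identity β)

theorem LForm.shift_inst (α : LForm L U) :
    (α.subst (lift shiftSub)).inst (Term.var 0) = α := by
  simp only [LForm.inst, LForm.subst_subst]
  conv_rhs => rw [← α.subst_var]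
  congr 1
  funext n
  cases n <;> rfl

theorem LForm.Banged.ex {α : LForm L U} (hα : α.Banged) : (LForm.ex α).Banged := by
  refine LProv.exL (Γ := 0) ?_
  refine LProv.promote (by simpa using hα) (LProv.exR (Term.var 0) ?_)
  rw [LForm.shift_inst]
  exact .identity α

/-- Atoms, implications and universals carry an explicit `!`; the remaining cases are positive
connectives, which preserve repeatability. -/
theorem IForm.star_banged (A : IForm L) : (A.star : LForm L U).Banged := by
  induction A with
  | atom | imp | all => exact LForm.banged_bang _
  | bot => exact banged_zero
  | top => exact banged_one
  | and _ _ ih₁ ih₂ => exact ih₁.tensor ih₂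
  | or _ _ ih₁ ih₂ => exact ih₁.plus ih₂
  | ex _ ih => exact ih.ex

/-- Sets of closed formulas of the form `!α`. -/
structure IsTheory (Θ : Set (LForm L U)) : Prop where
  banged : ∀ θ ∈ Θ, θ.Banged
  closed : ∀ θ ∈ Θ, θ.SupportedOn ∅

theorem IsTheory.union {Θ Θ' : Set (LForm L U)} (h : IsTheory Θ) (h' : IsTheory Θ') :
    IsTheory (Θ ∪ Θ') :=
  ⟨fun θ hθ => hθ.elim (h.banged θ) (h'.banged θ), fun θ hθ => hθ.elim (h.closed θ) (h'.closed θ)⟩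

/-- Derivability from finitely many members of `Θ` and the resources `Γ`. -/
def Derives (Θ : Set (LForm L U)) (Γ : Multiset (LForm L U)) (α : LForm L U) : Prop :=
  ∃ Δ : Multiset (LForm L U), (∀ δ ∈ Δ, δ ∈ Θ) ∧ LProv (Δ + Γ) α

/-! ### Sequent rules modulo a theory -/

namespace Derives

variable {Θ : Set (LForm L U)} {Γ Γ' : Multiset (LForm L U)} {α β γ : LForm L U}

theorem of_eq (h : Derives Θ Γ α) (e : Γ = Γ') : Derives Θ Γ' α := e ▸ h

theorem of_lprov (h : LProv Γ α) : Derives Θ Γ α := ⟨0, by simp, by simpa using h⟩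

theorem identity (α : LForm L U) : Derives Θ {α} α := of_lprov (.identity α)

theorem ax (h : α ∈ Θ) : Derives Θ 0 α := ⟨{α}, by simpa using h, by simpa using LProv.identity α⟩

theorem map₁ (h : Derives Θ Γ α)
    (f : ∀ Δ, (∀ δ ∈ Δ, δ ∈ Θ) → LProv (Δ + Γ) α → LProv (Δ + Γ') β) : Derives Θ Γ' β :=
  let ⟨Δ, hΔ, h⟩ := h
  ⟨Δ, hΔ, f Δ hΔ h⟩

theorem cut (h₁ : Derives Θ Γ α) (h₂ : Derives Θ (α ::ₘ Γ') β) : Derives Θ (Γ + Γ') β := by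
  obtain ⟨Δ₁, hΔ₁, h₁⟩ := h₁
  obtain ⟨Δ₂, hΔ₂, h₂⟩ := h₂
  refine ⟨Δ₁ + Δ₂, fun δ hδ => (Multiset.mem_add.1 hδ).elim (hΔ₁ δ) (hΔ₂ δ), ?_⟩
  rw [Multiset.add_cons] at h₂
  rw [add_add_add_comm]
  exact .cut h₁ h₂

theorem trans (h₁ : Derives Θ Γ α) (h₂ : Derives Θ {α} β) : Derives Θ Γ β :=
  (cut h₁ (Γ' := 0) h₂).of_eq (add_zero _)

theorem tensorR (h₁ : Derives Θ Γ α) (h₂ : Derives Θ Γ' β) :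
    Derives Θ (Γ + Γ') (α.tensor β) := by
  obtain ⟨Δ₁, hΔ₁, h₁⟩ := h₁
  obtain ⟨Δ₂, hΔ₂, h₂⟩ := h₂
  refine ⟨Δ₁ + Δ₂, fun δ hδ => (Multiset.mem_add.1 hδ).elim (hΔ₁ δ) (hΔ₂ δ), ?_⟩
  rw [add_add_add_comm]
  exact .tensorR h₁ h₂

theorem tensorL (h : Derives Θ (α ::ₘ β ::ₘ Γ) γ) : Derives Θ (α.tensor β ::ₘ Γ) γ :=
  h.map₁ fun Δ _ h => by
    rw [Multiset.add_cons] at h ⊢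
    rw [Multiset.add_cons] at h
    exact .tensorL h

theorem oneL (h : Derives Θ Γ γ) : Derives Θ (.one ::ₘ Γ) γ :=
  h.map₁ fun Δ _ h => by
    rw [Multiset.add_cons]
    exact .oneL h

theorem lolliR (h : Derives Θ (α ::ₘ Γ) β) : Derives Θ Γ (α.lolli β) :=
  h.map₁ fun Δ _ h => .lolliR (by rwa [Multiset.add_cons] at h)

theorem lolliE (h₁ : Derives Θ Γ (α.lolli β)) (h₂ : Derives Θ Γ' α) : Derives Θ (Γ + Γ') β := by
  refine cut h₁ ?_
  obtain ⟨Δ, hΔ, h₂⟩ := h₂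
  refine ⟨Δ, hΔ, ?_⟩
  rw [Multiset.add_cons]
  simpa using LProv.lolliL h₂ (.identity β : LProv (β ::ₘ 0) β)

theorem plusR₁ (h : Derives Θ Γ α) : Derives Θ Γ (α.plus β) := h.map₁ fun _ _ h => .plusR₁ h

theorem plusR₂ (h : Derives Θ Γ β) : Derives Θ Γ (α.plus β) := h.map₁ fun _ _ h => .plusR₂ h

/-- The two branches may use different axioms, while the rule needs a common context; each branch is
weakened by the axioms of the other. -/
theorem plusL (hΘ : IsTheory Θ) (h₁ : Derives Θ (α ::ₘ Γ) γ) (h₂ : Derives Θ (β ::ₘ Γ) γ) :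
    Derives Θ (α.plus β ::ₘ Γ) γ := by
  obtain ⟨Δ₁, hΔ₁, h₁⟩ := h₁
  obtain ⟨Δ₂, hΔ₂, h₂⟩ := h₂
  refine ⟨Δ₁ + Δ₂, fun δ hδ => (Multiset.mem_add.1 hδ).elim (hΔ₁ δ) (hΔ₂ δ), ?_⟩
  rw [Multiset.add_cons]
  have h₁' := h₁.weaken_banged fun δ hδ => hΘ.banged δ (hΔ₂ δ hδ)
  have h₂' := h₂.weaken_banged fun δ hδ => hΘ.banged δ (hΔ₁ δ hδ)
  rw [← add_assoc, Multiset.add_cons] at h₁' h₂'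
  rw [add_comm Δ₂ Δ₁] at h₁'
  exact .plusL h₁' h₂'

theorem zeroL : Derives Θ (.zero ::ₘ Γ) γ := of_lprov (.zeroL_cons _ _)

theorem bangL (h : Derives Θ (α ::ₘ Γ) β) : Derives Θ (α.bang ::ₘ Γ) β :=
  h.map₁ fun Δ _ h => by
    rw [Multiset.add_cons] at h ⊢
    exact .dereliction h

theorem bangE (h : Derives Θ Γ α.bang) : Derives Θ Γ α :=
  h.trans (bangL (Γ := 0) (identity α))

theorem promote (hΘ : IsTheory Θ) (hΓ : ∀ γ ∈ Γ, γ.Banged) (h : Derives Θ Γ α) :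
    Derives Θ Γ α.bang :=
  h.map₁ fun _ hΔ h => h.promote fun δ hδ =>
    (Multiset.mem_add.1 hδ).elim (fun h => hΘ.banged δ (hΔ δ h)) (hΓ δ)

theorem weaken (hΓ : ∀ γ ∈ Γ', γ.Banged) (h : Derives Θ Γ α) : Derives Θ (Γ' + Γ) α :=
  h.map₁ fun Δ _ h => by
    rw [add_left_comm]
    exact h.weaken_banged hΓ

theorem contract (hΓ : ∀ γ ∈ Γ', γ.Banged) (h : Derives Θ (Γ' + Γ' + Γ) α) :
    Derives Θ (Γ' + Γ) α :=
  h.map₁ fun Δ _ h => by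
    rw [add_left_comm] at h ⊢
    exact h.contract_banged hΓ

/-- Cut in which both premises use the same repeatable resources. -/
theorem cut_shared (hΓ : ∀ γ ∈ Γ, γ.Banged) (h₁ : Derives Θ Γ α)
    (h₂ : Derives Θ (α ::ₘ (Γ + Γ')) β) : Derives Θ (Γ + Γ') β :=
  contract hΓ ((h₁.cut h₂).of_eq (add_assoc _ _ _).symm)

/-- Closed axioms survive any substitution unchanged, so they never obstruct an eigenvariable rule.
-/
theorem theory_shift (hΘ : IsTheory Θ) {Δ : Multiset (LForm L U)} (hΔ : ∀ δ ∈ Δ, δ ∈ Θ)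
    (σ : ℕ → Tm L) : Δ.map (LForm.subst σ) = Δ := by
  conv_rhs => rw [← Multiset.map_id Δ]
  exact Multiset.map_congr rfl fun δ hδ => (hΘ.closed δ (hΔ δ hδ)).subst_eq_self σ

theorem subst (hΘ : IsTheory Θ) (h : Derives Θ Γ α) (σ : ℕ → Tm L) :
    Derives Θ (Γ.map (LForm.subst σ)) (α.subst σ) :=
  h.map₁ fun Δ hΔ h => by simpa [theory_shift hΘ hΔ σ] using h.subst σ

theorem allR (hΘ : IsTheory Θ) (h : Derives Θ (Γ.map LForm.shift) α) : Derives Θ Γ (.all α) :=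
  h.map₁ fun Δ hΔ h => .allR (by
    have := theory_shift hΘ hΔ shiftSub
    rw [Multiset.map_add]
    erw [this]
    exact h)

theorem allL (t : Tm L) (h : Derives Θ (α.inst t ::ₘ Γ) β) : Derives Θ (.all α ::ₘ Γ) β :=
  h.map₁ fun Δ _ h => by
    rw [Multiset.add_cons] at h ⊢
    exact .allL t h

theorem exR (t : Tm L) (h : Derives Θ Γ (α.inst t)) : Derives Θ Γ (.ex α) :=
  h.map₁ fun _ _ h => .exR t h

theorem exL (hΘ : IsTheory Θ) (h : Derives Θ (α ::ₘ Γ.map LForm.shift) β.shift) :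
    Derives Θ (.ex α ::ₘ Γ) β :=
  h.map₁ fun Δ hΔ h => by
    have := theory_shift hΘ hΔ shiftSub
    rw [Multiset.add_cons] at h ⊢
    refine .exL ?_
    rw [Multiset.map_add]
    erw [this]
    exact h

theorem subst_bindSub {x : ℕ} {A : Set ℕ} (hβ : β.SupportedOn A) (hx : x ∉ A) :
    β.subst (bindSub x) = β.shift :=
  hβ fun y hy => if_neg fun h : y = x => hx (h ▸ hy)

theorem map_subst_bindSub {x : ℕ} {A : Set ℕ} (hΓ : ∀ γ ∈ Γ, γ.SupportedOn A) (hx : x ∉ A) :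
    Γ.map (LForm.subst (bindSub x)) = Γ.map LForm.shift :=
  Multiset.map_congr rfl fun γ hγ => subst_bindSub (hΓ γ hγ) hx

/-- The witness for each bound `x` is `σ x`. Varying `τ` lets the induction record this choice:
after instantiation the ambient substitution is `τ` updated at `x`, which agrees with `σ` off the
rest of the prefix. -/
theorem foldr_exR {l : List ℕ} {σ τ : ℕ → Tm L} (hστ : ∀ x, x ∉ l → σ x = τ x)
    (h : Derives Θ Γ (α.subst σ)) : Derives Θ Γ ((l.foldr LForm.exVar α).subst τ) := by
  induction l generalizing τ with
  | nil => rwa [show τ = σ from funext fun x => (hστ x (by simp)).symm]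
  | cons x l ih =>
    refine exR (σ x) ?_
    rw [LForm.bindSub_inst]
    refine ih fun y hy => ?_
    by_cases hyx : y = x
    · simp [hyx]
    · rw [Function.update_of_ne hyx]
      exact hστ y (by simp [hyx, hy])

theorem exsR_subst {s : Finset ℕ} {σ τ : ℕ → Tm L} (hστ : ∀ x, x ∉ s → σ x = τ x)
    (h : Derives Θ Γ (α.subst σ)) : Derives Θ Γ ((LForm.exs s α).subst τ) :=
  foldr_exR (by simpa using hστ) h

theorem exsR (s : Finset ℕ) (h : Derives Θ Γ α) : Derives Θ Γ (LForm.exs s α) := by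
  have := exsR_subst (s := s) (σ := Term.var) (τ := Term.var) (fun _ _ => rfl)
    (by rwa [LForm.subst_var])
  rwa [LForm.subst_var] at this

theorem foldr_allL {l : List ℕ} {σ τ : ℕ → Tm L} (hστ : ∀ x, x ∉ l → σ x = τ x)
    (h : Derives Θ (α.subst σ ::ₘ Γ) β) :
    Derives Θ ((l.foldr LForm.allVar α).subst τ ::ₘ Γ) β := by
  induction l generalizing τ with
  | nil => rwa [show τ = σ from funext fun x => (hστ x (by simp)).symm]
  | cons x l ih =>
    refine allL (σ x) ?_
    rw [LForm.bindSub_inst]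
    refine ih fun y hy => ?_
    by_cases hyx : y = x
    · simp [hyx]
    · rw [Function.update_of_ne hyx]
      exact hστ y (by simp [hyx, hy])

theorem allsE {s : Finset ℕ} {σ : ℕ → Tm L} (hσ : ∀ x, x ∉ s → σ x = Term.var x)
    (h : Derives Θ Γ (LForm.alls s α)) : Derives Θ Γ (α.subst σ) := by
  refine h.trans ?_
  have := foldr_allL (Θ := Θ) (Γ := 0) (l := s.sort (· ≤ ·)) (τ := Term.var) (by simpa using hσ)
    (identity (α.subst σ))
  rwa [LForm.subst_var] at this

/-- The set `A` expresses the eigenvariable condition for named variables. Substituting `bindSub x`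
turns `x` into the bound index and acts as a mere shift on every formula whose support avoids `x`.
-/
theorem exsL (hΘ : IsTheory Θ) {s : Finset ℕ} {A : Set ℕ} (hs : ∀ x ∈ s, x ∉ A)
    (hΓ : ∀ γ ∈ Γ, γ.SupportedOn A) (hβ : β.SupportedOn A) (h : Derives Θ (α ::ₘ Γ) β) :
    Derives Θ (LForm.exs s α ::ₘ Γ) β := by
  have key : ∀ l : List ℕ, (∀ x ∈ l, x ∉ A) →
      Derives Θ (l.foldr LForm.exVar α ::ₘ Γ) β := by
    intro l hl
    induction l with
    | nil => exact h
    | cons x l ih =>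
      have h' := (ih fun y hy => hl y (by simp [hy])).subst hΘ (bindSub x)
      have hx := hl x (by simp)
      rw [Multiset.map_cons, subst_bindSub hβ hx, map_subst_bindSub hΓ hx] at h'
      exact exL hΘ h'
  exact key _ (by simpa using hs)

theorem allsR (hΘ : IsTheory Θ) {s : Finset ℕ} {A : Set ℕ} (hs : ∀ x ∈ s, x ∉ A)
    (hΓ : ∀ γ ∈ Γ, γ.SupportedOn A) (h : Derives Θ Γ α) : Derives Θ Γ (LForm.alls s α) := by
  have key : ∀ l : List ℕ, (∀ x ∈ l, x ∉ A) → Derives Θ Γ (l.foldr LForm.allVar α) := by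
    intro l hl
    induction l with
    | nil => exact h
    | cons x l ih =>
      have h' := (ih fun y hy => hl y (by simp [hy])).subst hΘ (bindSub x)
      rw [map_subst_bindSub hΓ (hl x (by simp))] at h'
      exact allR hΘ h'
  exact key _ (by simpa using hs)

end Derives

/-! ### Intuitionistic derivations in linear logic -/

theorem IProv.mono {T : Set (IForm L)} {Γ Γ' : List (IForm L)} {A : IForm L} (h : IProv T Γ A)
    (hΓ : Γ ⊆ Γ') : IProv T Γ' A := by
  induction h generalizing Γ' with
  | ax h => exact .ax h
  | hyp h => exact .hyp (hΓ h)
  | topI => exact .topI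
  | botE _ ih => exact .botE (ih hΓ)
  | andI _ _ ih₁ ih₂ => exact .andI (ih₁ hΓ) (ih₂ hΓ)
  | andE₁ _ ih => exact .andE₁ (ih hΓ)
  | andE₂ _ ih => exact .andE₂ (ih hΓ)
  | orI₁ _ ih => exact .orI₁ (ih hΓ)
  | orI₂ _ ih => exact .orI₂ (ih hΓ)
  | orE _ _ _ ih ih₁ ih₂ =>
    exact .orE (ih hΓ) (ih₁ (List.cons_subset_cons _ hΓ)) (ih₂ (List.cons_subset_cons _ hΓ))
  | impI _ ih => exact .impI (ih (List.cons_subset_cons _ hΓ))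
  | impE _ _ ih₁ ih₂ => exact .impE (ih₁ hΓ) (ih₂ hΓ)
  | allI _ ih => exact .allI (ih (List.map_subset _ hΓ))
  | allE t _ ih => exact .allE t (ih hΓ)
  | exI t _ ih => exact .exI t (ih hΓ)
  | exE _ _ ih₁ ih₂ => exact .exE (ih₁ hΓ) (ih₂ (List.cons_subset_cons _ (List.map_subset _ hΓ)))

/-- The hypotheses of an intuitionistic sequent in linear logic. -/
def starCtx (U : ℕ → Type w) (Γ : List (IForm L)) : Multiset (LForm L U) :=
  (Γ : Multiset (IForm L)).map IForm.star

theorem starCtx_cons (A : IForm L) (Γ : List (IForm L)) :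
    starCtx U (A :: Γ) = A.star ::ₘ starCtx U Γ := rfl

theorem starCtx_banged (Γ : List (IForm L)) : ∀ γ ∈ starCtx U Γ, γ.Banged := by
  intro γ hγ
  obtain ⟨A, -, rfl⟩ := Multiset.mem_map.1 hγ
  exact A.star_banged

theorem starCtx_shift (Γ : List (IForm L)) :
    starCtx U (Γ.map IForm.shift) = (starCtx U Γ).map LForm.shift := by
  induction Γ with
  | nil => rfl
  | cons A Γ ih => simp [starCtx_cons, ih, IForm.star_shift]

theorem IForm.star_inst (A : IForm L) (t : Tm L) :
    ((A.inst t).star : LForm L U) = A.star.inst t := A.star_subst _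

/-- Girard's embedding. Translated hypotheses are repeatable, so natural deduction's sharing and
discarding of hypotheses become contraction and weakening. -/
theorem IProv.derives {T : Set (IForm L)} {Θ : Set (LForm L U)} (hΘ : IsTheory Θ)
    (hT : ∀ A ∈ T, A.star ∈ Θ) {Γ : List (IForm L)} {A : IForm L} (h : IProv T Γ A) :
    Derives Θ (starCtx U Γ) A.star := by
  have two : ∀ {Γ : List (IForm L)} {α : LForm L U}, Derives Θ (starCtx U Γ + starCtx U Γ) α →
      Derives Θ (starCtx U Γ) α := fun {Γ α} h =>
    (Derives.contract (Γ := 0) (starCtx_banged Γ) (h.of_eq (add_zero _).symm)).of_eq (add_zero _)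
  have cutS : ∀ {Γ : List (IForm L)} {α β : LForm L U}, Derives Θ (starCtx U Γ) α →
      Derives Θ (α ::ₘ starCtx U Γ) β → Derives Θ (starCtx U Γ) β :=
    fun h₁ h₂ => two (h₁.cut h₂)
  have weak : ∀ {Γ : List (IForm L)} {α : LForm L U}, Derives Θ 0 α →
      Derives Θ (starCtx U Γ) α := fun {Γ α} h =>
    (h.weaken (starCtx_banged Γ)).of_eq (add_zero _)
  induction h with
  | ax h => exact weak (.ax (hT _ h))
  | @hyp Γ A h =>
    obtain ⟨Δ, hΔ⟩ := Multiset.exists_cons_of_mem (Multiset.mem_map_of_mem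
      (IForm.star (U := U)) (Multiset.mem_coe.2 h))
    have hb : ∀ γ ∈ Δ, γ.Banged := fun γ hγ => starCtx_banged (U := U) Γ γ (by
      rw [starCtx, hΔ]
      exact Multiset.mem_cons_of_mem hγ)
    refine ((Derives.identity A.star).weaken hb).of_eq ?_
    rw [starCtx, hΔ, add_comm, Multiset.singleton_add]
  | topI => exact weak (.of_lprov .oneR)
  | botE _ ih => exact ih.trans (.of_lprov (.zeroL _))
  | andI _ _ ih₁ ih₂ => exact two (ih₁.tensorR ih₂)
  | @andE₁ Γ A B _ ih =>
    refine ih.trans (.tensorL (Γ := 0) ?_)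
    exact ((Derives.identity A.star).weaken (Γ' := {B.star}) (by simpa using B.star_banged)).of_eq
      (by simp [add_comm])
  | @andE₂ Γ A B _ ih =>
    refine ih.trans (.tensorL (Γ := 0) ?_)
    exact ((Derives.identity B.star).weaken (Γ' := {A.star}) (by simpa using A.star_banged))
  | orI₁ _ ih => exact ih.plusR₁
  | orI₂ _ ih => exact ih.plusR₂
  | orE _ _ _ ih ih₁ ih₂ => exact cutS ih (.plusL hΘ ih₁ ih₂)
  | impI _ ih => exact .promote hΘ (starCtx_banged _) (.lolliR ih)
  | impE _ _ ih₁ ih₂ => exact two (ih₁.bangE.lolliE ih₂)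
  | allI _ ih => exact .promote hΘ (starCtx_banged _) (.allR hΘ (by rwa [← starCtx_shift]))
  | allE t _ ih =>
    rw [IForm.star_inst]
    exact ih.bangE.trans (.allL (Γ := 0) t (.identity _))
  | exI t _ ih => exact .exR t (by rwa [← IForm.star_inst])
  | exE _ _ ih₁ ih₂ =>
    refine cutS ih₁ (.exL hΘ ?_)
    rwa [← starCtx_shift, ← IForm.star_shift]

end Derivability

end CHR

namespace CHR

open FirstOrder.Language (Term)

/-! ### The constraint theory and equality inside linear logic -/

section Soundness

variable {L : FirstOrder.Language.{u, v}} {U : ℕ → Type w}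

theorem isTheory_theoryL (CT : ConstraintTheory L) : IsTheory (theoryL U CT) := by
  constructor
  · rintro θ (⟨a, -, rfl⟩ | ⟨n, c, j, rfl⟩)
    · exact IForm.star_banged _
    · exact LForm.banged_bang _
  · rintro θ (⟨a, -, rfl⟩ | ⟨n, c, j, rfl⟩)
    · exact a.star_toForm_supportedOn
    · exact userCongr_supportedOn c j

theorem Derives.of_iprov {CT : ConstraintTheory L} {Θ : Set (LForm L U)} (hΘ : IsTheory Θ)
    (hCT : theoryL U CT ⊆ Θ) {Γ : List (IForm L)} {A : IForm L}
    (h : IProv (CTAxiom.toForm '' CT) Γ A) : Derives Θ (starCtx U Γ) A.star := by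
  refine h.derives hΘ ?_
  rintro _ ⟨a, ha, rfl⟩
  exact hCT (.inl ⟨a, ha, rfl⟩)

/-! ### Equality -/

namespace HasEquality

variable {CT : ConstraintTheory L} {Γ : List (IForm L)}

theorem iprov_symm (h : HasEquality CT) {s t : Tm L}
    (hst : IProv (CTAxiom.toForm '' CT) Γ (.atom (.eq s t))) :
    IProv (CTAxiom.toForm '' CT) Γ (.atom (.eq t s)) :=
  .impE ((h.symm s t).mono (List.nil_subset _)) hst

theorem iprov_trans (h : HasEquality CT) {r s t : Tm L}
    (hrs : IProv (CTAxiom.toForm '' CT) Γ (.atom (.eq r s)))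
    (hst : IProv (CTAxiom.toForm '' CT) Γ (.atom (.eq s t))) :
    IProv (CTAxiom.toForm '' CT) Γ (.atom (.eq r t)) :=
  .impE ((h.trans r s t).mono (List.nil_subset _)) (.andI hrs hst)

theorem iprov_func (h : HasEquality CT) {n : ℕ} (f : L.Functions n) {ts ss : Fin n → Tm L}
    (hts : ∀ i, IProv (CTAxiom.toForm '' CT) Γ (.atom (.eq (ts i) (ss i)))) :
    IProv (CTAxiom.toForm '' CT) Γ (.atom (.eq (Term.func f ts) (Term.func f ss))) := by
  -- The congruence axioms change one argument at a time, so the induction is on the set `S` of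
  -- positions already replaced.
  have key : ∀ S : Finset (Fin n), IProv (CTAxiom.toForm '' CT) Γ
      (.atom (.eq (Term.func f ts) (Term.func f (S.piecewise ss ts)))) := by
    intro S
    induction S using Finset.induction with
    | empty => simpa using (h.refl _).mono (List.nil_subset _)
    | insert j S hj ih =>
      refine h.iprov_trans ih ?_
      rw [Finset.piecewise_insert]
      refine .impE ((h.func f (S.piecewise ss ts) j (ss j)).mono (List.nil_subset _)) ?_
      simpa [hj] using hts j
  simpa using key Finset.univ

theorem iprov_subst (h : HasEquality CT) {σ τ : ℕ → Tm L}
    (hστ : ∀ x, IProv (CTAxiom.toForm '' CT) Γ (.atom (.eq (σ x) (τ x)))) (t : Tm L) :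
    IProv (CTAxiom.toForm '' CT) Γ (.atom (.eq (t.subst σ) (t.subst τ))) := by
  induction t with
  | var x => exact hστ x
  | func f ts ih => exact h.iprov_func f ih

end HasEquality

theorem Derives.uatom_update {CT : ConstraintTheory L} {Θ : Set (LForm L U)}
    (hCT : theoryL U CT ⊆ Θ) {n : ℕ} (c : U n) (ts : Fin n → Tm L) (j : Fin n) (s : Tm L) :
    Derives Θ 0 (.lolli (.tensor (.uatom (.mk c ts)) (.bang (.batom (.eq (ts j) s))))
      (.tensor (.uatom (.mk c (Function.update ts j s))) (.bang (.batom (.eq (ts j) s))))) := by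
  have h₀ : Derives Θ 0 (userCongr c j : LForm L U) := .ax (hCT (.inr ⟨n, c, j, rfl⟩))
  have h := h₀.bangE.allsE
    -- The axiom's variables `0, …, n - 1` stand for the arguments and `n` for the new one; other
    -- variables are fixed, as `Derives.allsE` demands.
    (σ := fun k => if hk : k < n then ts ⟨k, hk⟩ else if k = n then s else Term.var k)
    (by
      intro x hx
      simp only [Finset.mem_range, not_lt] at hx
      have h₁ : ¬ x < n := by omega
      have h₂ : x ≠ n := by omega
      simp [h₁, h₂])
  convert h using 1
  simp only [LForm.subst, UAtom.subst, BAtom.subst, Term.subst]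
  have e : (fun i => Term.subst (Function.update (fun i : Fin n => (Term.var (i : ℕ) : Tm L)) j
      (Term.var n) i) fun k => if hk : k < n then ts ⟨k, hk⟩ else if k = n then s else Term.var k)
      = Function.update ts j s := by
    funext i
    by_cases hij : i = j
    · subst hij
      simp [Term.subst]
    · simp [hij, Term.subst]
  simp [e]

/-- Arguments are replaced one by one. The user atom is consumed and returned each time, whereas `ε`
is repeatable and can supply a fresh equation for every position. -/
theorem Derives.uatom_congr {CT : ConstraintTheory L} {Θ : Set (LForm L U)}
    (hCT : theoryL U CT ⊆ Θ) {ε : LForm L U} (hε : ε.Banged) {n : ℕ} (c : U n)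
    {ts ss : Fin n → Tm L} (h : ∀ i, Derives Θ {ε} (.bang (.batom (.eq (ts i) (ss i))))) :
    Derives Θ {ε, .uatom (.mk c ts)} (.uatom (.mk c ss)) := by
  have hb : ∀ γ ∈ ({ε} : Multiset (LForm L U)), γ.Banged := by simpa using hε
  have key : ∀ S : Finset (Fin n),
      Derives Θ ({ε} + {.uatom (.mk c ts)}) (.uatom (.mk c (S.piecewise ss ts))) := by
    intro S
    induction S using Finset.induction with
    | empty => simpa using (Derives.identity _).weaken hb
    | insert j S hj ih =>
      rw [Finset.piecewise_insert]
      have h₁ := (uatom_update hCT c (S.piecewise ss ts) j (ss j)).lolliE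
        (ih.tensorR (by simpa [hj] using h j))
      refine Derives.contract (Γ' := {ε}) hb (Derives.of_eq (h₁.trans ?_) (by abel))
      refine .tensorL (Γ := 0) ?_
      exact ((Derives.identity _).weaken (Γ' := {_})
        (by simpa using LForm.banged_bang _)).of_eq (add_comm _ _)
  simpa using key Finset.univ

theorem Derives.ucon_congr {CT : ConstraintTheory L} {Θ : Set (LForm L U)}
    (hCT : theoryL U CT ⊆ Θ) {ε : LForm L U} (hε : ε.Banged) {σ τ : ℕ → Tm L}
    (h : ∀ t : Tm L, Derives Θ {ε} (.bang (.batom (.eq (t.subst σ) (t.subst τ))))) (C : UCon L U) :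
    Derives Θ {ε, (C.subst σ).toGoal.toL} (C.subst τ).toGoal.toL := by
  have hb : ∀ γ ∈ ({ε} : Multiset (LForm L U)), γ.Banged := by simpa using hε
  induction C with
  | top => exact (Derives.identity _).weaken (Γ' := {ε}) hb
  | atom a =>
    cases a with
    | mk c ts => exact uatom_congr hCT hε c fun i => h (ts i)
  | and C C' ih ih' =>
    have h₁ := ih.tensorR ih'
    refine ((Derives.tensorL (Γ := {ε}) ?_).of_eq (Multiset.cons_swap _ _ _))
    refine (Derives.contract (Γ' := {ε}) hb
      (Γ := {(C.subst σ).toGoal.toL, (C'.subst σ).toGoal.toL}) (Derives.of_eq h₁ ?_)).of_eq ?_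
    · simp only [Multiset.insert_eq_cons, ← Multiset.singleton_add]
      abel
    · simp only [Multiset.insert_eq_cons, ← Multiset.singleton_add]
      abel

/-- Under `x ≐ t` the identity substitution and `single x t` are pointwise equal, hence equal on all
terms; symmetry gives the converse direction. -/
theorem HasEquality.derives_subst {CT : ConstraintTheory L} (hEq : HasEquality CT)
    {Θ : Set (LForm L U)} (hΘ : IsTheory Θ) (hCT : theoryL U CT ⊆ Θ) (x : ℕ) (t : Tm L)
    (C : UCon L U) :
    Derives Θ {.bang (.batom (.eq (Term.var x) t)), C.toGoal.toL} (C.subst (single x t)).toGoal.toL ∧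
    Derives Θ {.bang (.batom (.eq (Term.var x) t)), (C.subst (single x t)).toGoal.toL}
      C.toGoal.toL := by
  have hx : ∀ y, IProv (CTAxiom.toForm '' CT) [.atom (.eq (Term.var x) t)]
      (.atom (.eq (Term.var y) (single x t y))) := by
    intro y
    by_cases hy : y = x
    · subst hy
      simpa [single] using IProv.hyp (by simp)
    · simpa [single, hy] using (hEq.refl _).mono (List.nil_subset _)
  have h₁ : ∀ s : Tm L, Derives Θ {.bang (.batom (.eq (Term.var x) t))}
      (.bang (.batom (.eq (s.subst Term.var) (s.subst (single x t))))) := fun s =>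
    .of_iprov hΘ hCT (hEq.iprov_subst hx s)
  have h₂ : ∀ s : Tm L, Derives Θ {.bang (.batom (.eq (Term.var x) t))}
      (.bang (.batom (.eq (s.subst (single x t)) (s.subst Term.var)))) := fun s =>
    .of_iprov hΘ hCT (hEq.iprov_symm (hEq.iprov_subst hx s))
  have e₁ := Derives.ucon_congr hCT (LForm.banged_bang _) h₁ C
  have e₂ := Derives.ucon_congr hCT (LForm.banged_bang _) h₂ C
  rw [UCon.subst_var] at e₁ e₂
  exact ⟨e₁, e₂⟩

end Soundness

end CHR

namespace CHR

open FirstOrder.Language (Term)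

/-! ### Soundness of state equivalence and transitions -/

section Soundness

variable {L : FirstOrder.Language.{u, v}} {U : ℕ → Type w}

/-! ### Entailment between formulas -/

namespace Derives

variable {Θ : Set (LForm L U)} {Γ : Multiset (LForm L U)} {α α' β β' γ : LForm L U}

theorem tensor_mono (h : Derives Θ {α} α') (h' : Derives Θ {β} β') :
    Derives Θ {α.tensor β} (α'.tensor β') :=
  tensorL (Γ := 0) ((h.tensorR h').of_eq rfl)

theorem tensor_comm : Derives Θ {α.tensor β} (β.tensor α) :=
  tensorL (Γ := 0) (((identity β).tensorR (identity α)).of_eq (add_comm _ _))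

theorem tensor_assoc :
    Derives Θ {(α.tensor β).tensor γ} (α.tensor (β.tensor γ)) := by
  refine tensorL (Γ := 0) (tensorL ?_)
  exact ((identity α).tensorR ((identity β).tensorR (identity γ))).of_eq rfl

theorem tensor_assoc_symm :
    Derives Θ {α.tensor (β.tensor γ)} ((α.tensor β).tensor γ) := by
  refine tensorL (Γ := 0) (of_eq (tensorL (α := β) (β := γ) (Γ := {α}) ?_)
    (Multiset.cons_swap _ _ _))
  refine (((identity α).tensorR (identity β)).tensorR (identity γ)).of_eq ?_
  simp only [← Multiset.singleton_add]
  abel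

theorem plus_mono (hΘ : IsTheory Θ) (h : Derives Θ {α} α') (h' : Derives Θ {β} β') :
    Derives Θ {α.plus β} (α'.plus β') :=
  plusL hΘ (Γ := 0) h.plusR₁ h'.plusR₂

theorem tensor_plus (hΘ : IsTheory Θ) :
    Derives Θ {α.tensor (β.plus γ)} ((α.tensor β).plus (α.tensor γ)) := by
  refine tensorL (Γ := 0) (of_eq (plusL hΘ (α := β) (β := γ) (Γ := {α}) ?_ ?_)
    (Multiset.cons_swap _ _ _))
  · exact (((identity α).tensorR (identity β)).of_eq (add_comm _ _)).plusR₁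
  · exact (((identity α).tensorR (identity γ)).of_eq (add_comm _ _)).plusR₂

theorem plus_tensor (hΘ : IsTheory Θ) :
    Derives Θ {(α.tensor β).plus (α.tensor γ)} (α.tensor (β.plus γ)) :=
  plusL hΘ (Γ := 0) (tensor_mono (identity α) (identity β).plusR₁)
    (tensor_mono (identity α) (identity γ).plusR₂)

end Derives

/-- Mutual derivability under `Θ`. -/
def Interderivable (Θ : Set (LForm L U)) (α β : LForm L U) : Prop :=
  Derives Θ {α} β ∧ Derives Θ {β} α

namespace Interderivable

variable {Θ : Set (LForm L U)} {α β γ : LForm L U}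

theorem refl (α : LForm L U) : Interderivable Θ α α := ⟨.identity α, .identity α⟩

theorem symm (h : Interderivable Θ α β) : Interderivable Θ β α := ⟨h.2, h.1⟩

theorem trans (h : Interderivable Θ α β) (h' : Interderivable Θ β γ) : Interderivable Θ α γ :=
  ⟨h.1.trans h'.1, h'.2.trans h.2⟩

end Interderivable

theorem GoalEquiv.interderivable {Θ : Set (LForm L U)} (hΘ : IsTheory Θ) {G G' : Goal L U}
    (h : GoalEquiv G G') : Interderivable Θ G.toL G'.toL := by
  induction h with
  | refl G => exact .refl _
  | symm _ ih => exact ih.symm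
  | trans _ _ ih ih' => exact ih.trans ih'
  | and_congr _ _ ih ih' => exact ⟨.tensor_mono ih.1 ih'.1, .tensor_mono ih.2 ih'.2⟩
  | or_congr _ _ ih ih' => exact ⟨.plus_mono hΘ ih.1 ih'.1, .plus_mono hΘ ih.2 ih'.2⟩
  | and_assoc => exact ⟨.tensor_assoc, .tensor_assoc_symm⟩
  | and_comm => exact ⟨.tensor_comm, .tensor_comm⟩
  | and_top G =>
    refine ⟨.tensorL (Γ := 0) ?_, ?_⟩
    · exact (Derives.oneL (.identity G.toL)).of_eq (Multiset.cons_swap _ _ 0)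
    · exact ((Derives.identity G.toL).tensorR (.of_lprov .oneR)).of_eq (add_zero _)
  | and_or => exact ⟨.tensor_plus hΘ, .plus_tensor hΘ⟩

/-! ### States and configurations in linear logic -/

open Classical in
/-- The linear-logic reading of a state: its local variables are existentially quantified. -/
noncomputable def State.toL (S : State L U) : LForm L U :=
  LForm.exs (S.goal.vars.filter (· ∉ S.globals)) S.goal.toL

/-- The linear-logic reading of a configuration. -/
noncomputable def Config.toL (S : Config L U) : LForm L U :=
  (S.map State.toL).foldr LForm.plus .zero

theorem State.toL_supportedOn (G : Goal L U) (V : Set ℕ) :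
    (State.toL ⟨G, V⟩).SupportedOn ((G.vars : Set ℕ) ∩ V) := by
  refine (G.toL_supportedOn.exs _).mono fun x hx => ?_
  simp only [Set.mem_sdiff, Finset.mem_coe, Finset.mem_filter, not_and, not_not] at hx
  exact ⟨hx.1, hx.2 hx.1⟩

theorem Derives.stateR {Θ : Set (LForm L U)} {Γ : Multiset (LForm L U)} {G : Goal L U}
    (V : Set ℕ) (h : Derives Θ Γ G.toL) : Derives Θ Γ (State.toL ⟨G, V⟩) :=
  .exsR _ h

/-- A conclusion depending only on global variables cannot mention the local ones, which may
therefore serve as eigenvariables. -/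
theorem Derives.stateL {Θ : Set (LForm L U)} (hΘ : IsTheory Θ) {G : Goal L U} {V : Set ℕ}
    {β : LForm L U} (hβ : β.SupportedOn V) (h : Derives Θ {G.toL} β) :
    Derives Θ {State.toL ⟨G, V⟩} β :=
  .exsL (Γ := 0) (A := V) hΘ (by simp) (by simp) hβ h

theorem Derives.state {Θ : Set (LForm L U)} (hΘ : IsTheory Θ) {G G' : Goal L U} {V : Set ℕ}
    (h : Derives Θ {G.toL} G'.toL) : Derives Θ {State.toL ⟨G, V⟩} (State.toL ⟨G', V⟩) :=
  .stateL hΘ ((State.toL_supportedOn G' V).mono Set.inter_subset_right) (.stateR V h)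

theorem Derives.state_of_zero {Θ : Set (LForm L U)} (hΘ : IsTheory Θ) (G : Goal L U) (V : Set ℕ)
    (β : LForm L U) : Derives Θ {State.toL ⟨.and G .bot, V⟩} β := by
  refine Derives.trans (α := .zero) ?_ (.of_lprov (.zeroL β))
  refine .stateL hΘ (fun _ _ _ => rfl) (.tensorL (Γ := 0) ?_)
  exact (Derives.zeroL (Γ := {G.toL})).of_eq (Multiset.cons_swap _ _ 0)

/-- The theory turns `B` into an existential over strictly local variables of `B'`. These are
neither global nor in `C`, so it can be opened beside `C`; the other local variables have already
been opened with the state. -/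
theorem Derives.state_appCT {CT : ConstraintTheory L} {Θ : Set (LForm L U)} (hΘ : IsTheory Θ)
    (hCT : theoryL U CT ⊆ Θ) (C : UCon L U) (B B' : BCon L) (V : Set ℕ)
    (h : Models CT (.imp (IForm.exs (strictlyLocal C B V) B.toForm)
      (IForm.exs (strictlyLocal C B' V) B'.toForm))) :
    Derives Θ {State.toL ⟨.and C.toGoal B.toGoal, V⟩}
      (State.toL ⟨.and C.toGoal B'.toGoal, V⟩) := by
  have h₁ : Derives Θ 0 _ := (Derives.of_iprov hΘ hCT h).bangE
  rw [IForm.star_exs, IForm.star_exs, BCon.star_toForm, BCon.star_toForm] at h₁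
  have h₂ : Derives Θ {B.toGoal.toL}
      (LForm.exs (strictlyLocal C B' V) (B'.toGoal : Goal L U).toL) :=
    (h₁.lolliE (.exsR _ (.identity _))).of_eq (zero_add _)
  have hsupp := (State.toL_supportedOn (.and C.toGoal B'.toGoal) V).mono Set.inter_subset_right
  refine .stateL hΘ hsupp (.tensorL (Γ := 0) ?_)
  refine (h₂.cut (Γ' := {C.toGoal.toL}) (β := State.toL ⟨.and C.toGoal B'.toGoal, V⟩) ?_).of_eq
    (add_comm _ _)
  refine .exsL hΘ (A := V ∪ C.vars) ?_ ?_ (hsupp.mono Set.subset_union_left) ?_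
  · intro x hx
    simp only [strictlyLocal, Finset.mem_filter] at hx
    simp [hx.2]
  · simp only [Multiset.mem_singleton, forall_eq]
    refine C.toGoal.toL_supportedOn.mono ?_
    rw [UCon.vars_toGoal]
    exact Set.subset_union_right
  · refine .stateR V ?_
    exact ((Derives.identity _).tensorR (Derives.identity _)).of_eq (add_comm _ _)

theorem Derives.eqSubst {Θ : Set (LForm L U)} {α α' β ε : LForm L U} (hε : ε.Banged)
    (h : Derives Θ {ε, α} α') :
    Derives Θ {(α.tensor ε).tensor β} ((α'.tensor ε).tensor β) := by
  refine .tensor_mono (.tensorL (Γ := 0) ?_) (.identity β)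
  refine (Derives.contract (Γ' := {ε}) (Γ := {α}) (by simpa using hε)
    ((h.tensorR (.identity ε)).of_eq ?_)).of_eq (add_comm _ _)
  simp only [Multiset.insert_eq_cons, ← Multiset.singleton_add]
  abel

theorem StateEquiv.interderivable {CT : ConstraintTheory L} (hEq : HasEquality CT)
    {Θ : Set (LForm L U)} (hΘ : IsTheory Θ) (hCT : theoryL U CT ⊆ Θ) {S S' : State L U}
    (h : StateEquiv CT S S') : Interderivable Θ S.toL S'.toL := by
  induction h with
  | refl S => exact .refl _
  | symm _ ih => exact ih.symm
  | trans _ _ ih ih' => exact ih.trans ih'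
  | goal V h => exact ⟨.state hΘ (h.interderivable hΘ).1, .state hΘ (h.interderivable hΘ).2⟩
  | eqSubst C x t B V =>
    obtain ⟨h₁, h₂⟩ := hEq.derives_subst hΘ hCT x t C
    exact ⟨.state hΘ (.eqSubst (LForm.banged_bang _) h₁),
      .state hΘ (.eqSubst (LForm.banged_bang _) h₂)⟩
  | appCT C B B' V h => exact ⟨.state_appCT hΘ hCT C B B' V h.andE₁,
      .state_appCT hΘ hCT C B' B V h.andE₂⟩
  | global G x V hx =>
    -- A variable absent from the goal is never quantified, so the two readings coincide literally.
    have e : State.toL ⟨G, {x} ∪ V⟩ = State.toL ⟨G, V⟩ := by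
      unfold State.toL
      congr 1
      ext y
      simp only [Finset.mem_filter, Set.mem_union, Set.mem_singleton_iff]
      grind
    rw [e]
    exact .refl _
  | fail G G' V V' => exact ⟨.state_of_zero hΘ G V _, .state_of_zero hΘ G' V' _⟩

theorem ConfigEquiv.interderivable {CT : ConstraintTheory L} (hEq : HasEquality CT)
    {Θ : Set (LForm L U)} (hΘ : IsTheory Θ) (hCT : theoryL U CT ⊆ Θ) {S S' : Config L U}
    (h : ConfigEquiv CT S S') : Interderivable Θ S.toL S'.toL := by
  have hperm : ∀ {S S' : Config L U}, S.Perm S' → Derives Θ {S.toL} S'.toL := by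
    intro S S' h
    induction h with
    | nil => exact .identity _
    | cons S _ ih => exact .plus_mono hΘ (.identity _) ih
    | swap S S' T =>
      exact .plusL hΘ (Γ := 0) (Derives.identity _).plusR₁.plusR₂
        (.plusL hΘ (Γ := 0) (Derives.identity _).plusR₁ (Derives.identity _).plusR₂.plusR₂)
    | trans _ _ ih ih' => exact ih.trans ih'
  induction h with
  | refl S => exact .refl _
  | symm _ ih => exact ih.symm
  | trans _ _ ih ih' => exact ih.trans ih'
  | perm h => exact ⟨hperm h, hperm h.symm⟩
  | state T h =>
    have := h.interderivable hEq hΘ hCT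
    exact ⟨.plus_mono hΘ this.1 (.identity _), .plus_mono hΘ this.2 (.identity _)⟩
  | fail T =>
    exact ⟨.plusL hΘ (Γ := 0) (.state_of_zero hΘ _ _ _) (.identity _),
      (Derives.identity _).plusR₂⟩
  | split G₁ G₂ V T =>
    constructor
    -- Existential quantification distributes over `⊕`: open all local variables of the disjunction,
    -- then requantify in each branch only those it contains.
    · refine .plusL hΘ (Γ := 0) ?_ (Derives.identity _).plusR₂.plusR₂
      refine Derives.trans (α := .plus (State.toL ⟨G₁, V⟩) (State.toL ⟨G₂, V⟩)) ?_ ?_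
      · refine .stateL hΘ ?_ (.plusL hΘ (Γ := 0) ?_ ?_)
        · exact ((State.toL_supportedOn _ _).mono Set.inter_subset_right).plus
            ((State.toL_supportedOn _ _).mono Set.inter_subset_right)
        · exact (Derives.stateR V (.identity _)).plusR₁
        · exact (Derives.stateR V (.identity _)).plusR₂
      · exact .plusL hΘ (Γ := 0) (Derives.identity _).plusR₁ (Derives.identity _).plusR₁.plusR₂
    · refine .plusL hΘ (Γ := 0) (Derives.plusR₁ (.state hΘ (Derives.identity _).plusR₁))
        (.plusL hΘ (Γ := 0) (Derives.plusR₁ (.state hΘ (Derives.identity _).plusR₂))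
          (Derives.identity _).plusR₂)

/-! ### Rules -/

/-- The linear implication expressed by a rule, with its free variables. -/
def Rule.matrix (R : Rule L U) : LForm L U :=
  .lolli (.tensor (.tensor R.H₁.toGoal.toL R.H₂.toGoal.toL) R.G.toGoal.toL)
    (.tensor R.H₁.toGoal.toL (LForm.exs R.localVars (.tensor R.B.toL R.G.toGoal.toL)))

/-- Body and guard variables outside the head are exactly the local ones, which are bound here. Thus
the consequent is a legitimate target for `Derives.stateL` when the head variables are global. -/
theorem Rule.matrix_right_supportedOn (R : Rule L U) :
    (LForm.tensor R.H₁.toGoal.toL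
      (LForm.exs R.localVars (.tensor R.B.toL R.G.toGoal.toL))).SupportedOn R.headVars := by
  refine (R.H₁.toGoal.toL_supportedOn.mono ?_).tensor
    ((((R.B.toL_supportedOn.mono ?_).tensor (R.G.toGoal.toL_supportedOn.mono ?_)).exs _).mono
      (A := (R.B.vars ∪ R.G.vars : Finset ℕ) \ R.localVars) ?_)
  · simp [UCon.vars_toGoal, Rule.headVars]
  · simp
  · simp [BCon.vars_toGoal]
  · intro x
    simp only [Rule.localVars, Set.mem_sdiff, Finset.mem_coe, Finset.mem_sdiff]
    tauto

theorem Rule.toL_supportedOn (R : Rule L U) : R.toL.SupportedOn ∅ := by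
  refine (LForm.SupportedOn.alls (A := (R.headVars ∪ R.G.vars : Finset ℕ)) (.lolli ?_
    (R.matrix_right_supportedOn.mono ?_)) _).bang.mono (by simp)
  · refine (LForm.SupportedOn.tensor ?_ ?_).tensor ?_
    · exact R.H₁.toGoal.toL_supportedOn.mono (by simp [UCon.vars_toGoal, Rule.headVars])
    · exact R.H₂.toGoal.toL_supportedOn.mono (by simp [UCon.vars_toGoal, Rule.headVars]; grind)
    · exact R.G.toGoal.toL_supportedOn.mono (by simp [BCon.vars_toGoal])
  · simp

theorem isTheory_rules (P : Program L U) : IsTheory {α | ∃ R ∈ P, α = Rule.toL R} := by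
  constructor
  · rintro _ ⟨R, -, rfl⟩
    exact LForm.banged_bang _
  · rintro _ ⟨R, -, rfl⟩
    exact R.toL_supportedOn

/-- Prefixes are sorted, and `π` may change the order, so the two formulas need not coincide and are
related by a derivation. It is built after pulling the target back along `π⁻¹`, then transported by
`π`. -/
theorem Derives.exs_rename {Θ : Set (LForm L U)} (hΘ : IsTheory Θ) (π : Equiv.Perm ℕ)
    (s : Finset ℕ) (α : LForm L U) :
    Derives Θ {(LForm.exs s α).subst fun x => Term.var (π x)}
      (LForm.exs (s.image π) (α.subst fun x => Term.var (π x))) := by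
  set β := LForm.exs (s.image π) (α.subst fun x => Term.var (π x))
  have hβ : (β.subst fun x => Term.var (π.symm x)).SupportedOn {x | x ∉ s} := by
    have h : β.SupportedOn _ := LForm.SupportedOn.exs (A := Set.univ)
      (fun σ τ h => by rw [funext fun x => h x trivial]) _
    refine (h.subst_rename π.symm).mono ?_
    rintro _ ⟨y, hy, rfl⟩ hs
    exact hy.2 (Finset.mem_coe.2 (Finset.mem_image.2 ⟨π.symm y, hs, π.apply_symm_apply y⟩))
  have key : Derives Θ {LForm.exs s α} (β.subst fun x => Term.var (π.symm x)) := by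
    refine .exsL (Γ := 0) (A := {x | x ∉ s}) hΘ (by simp) (by simp) hβ ?_
    refine .exsR_subst (fun _ _ => rfl) ?_
    rw [LForm.subst_subst]
    simp only [Term.subst, Equiv.symm_apply_apply]
    rw [LForm.subst_var]
    exact .identity α
  have h := key.subst hΘ fun x => Term.var (π x)
  rw [LForm.subst_subst] at h
  simp only [Term.subst, Equiv.apply_symm_apply] at h
  rwa [LForm.subst_var, Multiset.map_singleton] at h

/-- An injection on the finitely many variables of a rule extends to a permutation of `ℕ`;
invertibility is what `Derives.exs_rename` requires. -/
theorem Rule.IsVariant.exists_perm {R₀ R : Rule L U} (h : R₀.IsVariant R) :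
    ∃ π : Equiv.Perm ℕ, R = R₀.subst fun x => Term.var (π x) := by
  obtain ⟨ρ, hρ, rfl⟩ := h
  obtain ⟨π, hπ⟩ := Cardinal.extend_function_of_lt (s := (R₀.vars : Set ℕ))
    ⟨fun x => ρ x, fun x y hxy => Subtype.ext (hρ x.2 y.2 hxy)⟩
    (by simp) ⟨Equiv.refl ℕ⟩
  refine ⟨π, Rule.subst_congr fun x hx => ?_⟩
  exact congrArg Term.var (hπ ⟨x, hx⟩).symm

theorem Rule.localVars_rename (R : Rule L U) (π : Equiv.Perm ℕ) :
    (R.subst fun x => Term.var (π x)).localVars = R.localVars.image π := by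
  simp [Rule.localVars, Rule.headVars, Rule.subst, BCon.vars_rename, UCon.vars_rename,
    Goal.vars_rename, Finset.image_sdiff _ _ π.injective, Finset.image_union]

theorem Rule.derives_matrix {Θ : Set (LForm L U)} (hΘ : IsTheory Θ) {R₀ R : Rule L U}
    (h₀ : R₀.toL ∈ Θ) (hR : R₀.IsVariant R) : Derives Θ 0 R.matrix := by
  obtain ⟨π, rfl⟩ := hR.exists_perm
  -- Quantifiers are first stripped with the identity instance; the renaming then acts on a
  -- derivation from closed axioms.
  have h₁ : Derives Θ 0 (R₀.matrix.subst Term.var) :=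
    (Derives.ax h₀).bangE.allsE (fun _ _ => rfl)
  have h₂ := h₁.subst hΘ fun x => Term.var (π x)
  rw [LForm.subst_var] at h₂
  have h₃ := Derives.exs_rename hΘ π R₀.localVars (.tensor R₀.B.toL R₀.G.toGoal.toL)
  rw [← Rule.localVars_rename] at h₃
  simp only [Rule.matrix, LForm.subst, ← Goal.toL_subst, ← UCon.toGoal_subst,
    ← BCon.toGoal_subst] at h₂ h₃
  refine .lolliR ?_
  refine ((h₂.lolliE (.identity _)).of_eq (zero_add _)).trans ?_
  exact .tensor_mono (.identity _) h₃

/-! ### Soundness of the operational semantics -/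

/-- The local variables are fresh for `G`, `V` and the head, which is the eigenvariable condition
for opening the rule's existential. The guard is consumed with the head but returned beside the
body. -/
theorem Derives.apply_rule {Θ : Set (LForm L U)} (hΘ : IsTheory Θ) {R : Rule L U}
    (hR : Derives Θ 0 R.matrix) {G : Goal L U} {V : Set ℕ}
    (hloc : ∀ y ∈ R.localVars, y ∉ G.vars ∧ y ∉ V) :
    Derives Θ
      {State.toL ⟨.and (.and (.and R.H₁.toGoal R.H₂.toGoal) R.G.toGoal) G, V⟩}
      (State.toL ⟨.and (.and (.and R.H₁.toGoal R.G.toGoal) R.B) G, V⟩) := by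
  set G' : Goal L U := .and (.and (.and R.H₁.toGoal R.G.toGoal) R.B) G
  have hsupp := (State.toL_supportedOn G' V).mono Set.inter_subset_right
  refine .stateL hΘ hsupp (.tensorL (Γ := 0) ?_)
  have h := (hR.lolliE (.identity _)).of_eq (zero_add _)
  refine Derives.of_eq (h.cut (Γ' := {G.toL}) (.tensorL ?_)) rfl
  refine of_eq (.exsL (s := R.localVars) (Γ := {R.H₁.toGoal.toL, G.toL}) hΘ
    (A := R.headVars ∪ G.vars ∪ V) ?_ ?_ (hsupp.mono Set.subset_union_right)
    (.tensorL (.stateR V ?_))) (Multiset.cons_swap _ _ _)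
  · intro y hy
    have h₁ := hloc y hy
    have h₂ : y ∉ R.headVars := (Finset.mem_sdiff.1 hy).2
    simp [h₁, h₂]
  · intro γ hγ
    simp only [Multiset.insert_eq_cons, Multiset.mem_cons, Multiset.mem_singleton] at hγ
    rcases hγ with rfl | rfl
    · refine R.H₁.toGoal.toL_supportedOn.mono fun x hx => ?_
      rw [UCon.vars_toGoal] at hx
      exact .inl (.inl (Finset.mem_union_left _ hx))
    · exact G.toL_supportedOn.mono fun x hx => .inl (.inr hx)
  · refine ((((Derives.identity _).tensorR (.identity _)).tensorR (.identity _)).tensorR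
      (.identity _)).of_eq ?_
    simp only [Multiset.insert_eq_cons, ← Multiset.singleton_add]
    abel

/-- Transitions relate equivalence classes, so arbitrary representatives are allowed;
`ConfigEquiv.interderivable` moves to and from those at which the rule is applied. -/
theorem Step.derives {CT : ConstraintTheory L} (hEq : HasEquality CT)
    {Θ : Set (LForm L U)} (hΘ : IsTheory Θ) (hCT : theoryL U CT ⊆ Θ) {P : Program L U}
    (hP : ∀ R ∈ P, R.toL ∈ Θ) {c c' : ConfigClass U CT} (h : Step CT P c c') {S S' : Config L U}
    (hS : Config.cls CT S = c) (hS' : Config.cls CT S' = c') : Derives Θ {S.toL} S'.toL := by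
  obtain ⟨R₀, R, G, V, T, hR₀, hR, hloc, -⟩ := h
  have e₁ : ConfigEquiv CT S _ := Quotient.exact hS
  have e₂ : ConfigEquiv CT S' _ := Quotient.exact hS'
  refine (e₁.interderivable hEq hΘ hCT).1.trans (.trans ?_ (e₂.interderivable hEq hΘ hCT).2)
  exact .plus_mono hΘ (.apply_rule hΘ (Rule.derives_matrix hΘ (hP _ hR₀) hR) hloc) (.identity _)

theorem computable_derives {CT : ConstraintTheory L} (hEq : HasEquality CT)
    {Θ : Set (LForm L U)} (hΘ : IsTheory Θ) (hCT : theoryL U CT ⊆ Θ) {P : Program L U}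
    (hP : ∀ R ∈ P, R.toL ∈ Θ) {S : State L U} {T : Config L U}
    (h : Config.cls CT T ∈ computable CT P S) : Derives Θ {S.toL} T.toL := by
  have key : ∀ c, Relation.ReflTransGen (Step CT P) (Config.cls CT [S]) c →
      ∀ T, Config.cls CT T = c → Derives Θ {Config.toL [S]} T.toL := by
    intro c hc
    induction hc with
    | refl =>
      intro T hT
      have e : ConfigEquiv CT T [S] := Quotient.exact hT
      exact (e.interderivable hEq hΘ hCT).2
    | @tail b c _ hstep ih =>
      intro T hT
      obtain ⟨T', rfl⟩ := Quotient.exists_rep b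
      exact (ih T' rfl).trans (hstep.derives hEq hΘ hCT hP rfl hT)
  exact (Derives.identity S.toL).plusR₁.trans (key _ h T rfl)

end Soundness

end CHR

namespace CHR

open FirstOrder.Language (Term)

/-! ### From operational to logical equivalence -/

section LogicalEquivalence

variable {L : FirstOrder.Language.{u, v}} {U : ℕ → Type w}

/-! ### Programs as resources -/

/-- Exchanges the axioms in `Θ'` for one repeatable resource: each of the finitely many axioms used
is cut against a copy of `π`, and the copies are contracted. -/
theorem Derives.of_union {Θ Θ' : Set (LForm L U)} {π : LForm L U} (hπ : π.Banged)
    (hΘ' : ∀ θ ∈ Θ', Derives Θ {π} θ) {Γ : Multiset (LForm L U)} {α : LForm L U}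
    (h : Derives (Θ ∪ Θ') Γ α) : Derives Θ (π ::ₘ Γ) α := by
  obtain ⟨Δ, hΔ, h⟩ := h
  have hb : ∀ γ ∈ ({π} : Multiset (LForm L U)), γ.Banged := by simpa using hπ
  induction Δ using Multiset.induction generalizing Γ with
  | empty => exact (Derives.of_lprov (by simpa using h)).weaken hb
  | cons δ Δ ih =>
    have h₁ := ih (Γ := δ ::ₘ Γ) (fun θ hθ => hΔ θ (Multiset.mem_cons_of_mem hθ))
      (by simpa [Multiset.add_cons] using h)
    rw [Multiset.cons_swap] at h₁
    rcases hΔ δ (Multiset.mem_cons_self _ _) with hδ | hδ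
    · exact ((Derives.ax hδ).cut h₁).of_eq (zero_add _)
    · exact Derives.cut_shared (Γ' := Γ) hb (hΘ' δ hδ) h₁

theorem banged_foldr_tensor {l : List (LForm L U)} (hl : ∀ α ∈ l, α.Banged) :
    (l.foldr LForm.tensor .one).Banged := by
  induction l with
  | nil => exact banged_one
  | cons α l ih =>
    exact (hl α (by simp)).tensor (ih fun β hβ => hl β (by simp [hβ]))

theorem Derives.of_mem_foldr_tensor {Θ : Set (LForm L U)} {l : List (LForm L U)}
    (hl : ∀ α ∈ l, α.Banged) {α : LForm L U} (hα : α ∈ l) :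
    Derives Θ {l.foldr LForm.tensor .one} α := by
  induction l with
  | nil => simp at hα
  | cons β l ih =>
    have hl' : ∀ α ∈ l, α.Banged := fun γ hγ => hl γ (by simp [hγ])
    refine .tensorL (Γ := 0) ?_
    rcases List.mem_cons.1 hα with rfl | hα
    · exact ((Derives.identity α).weaken (Γ' := {l.foldr LForm.tensor .one})
        (by simpa using banged_foldr_tensor hl')).of_eq (add_comm _ _)
    · exact (ih hl' hα).weaken (Γ' := {β}) (by simpa using hl β (by simp))

theorem Derives.foldr_tensor {Θ : Set (LForm L U)} {Γ : Multiset (LForm L U)}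
    (hΓ : ∀ γ ∈ Γ, γ.Banged) {l : List (LForm L U)} (hl : ∀ α ∈ l, Derives Θ Γ α) :
    Derives Θ Γ (l.foldr LForm.tensor .one) := by
  induction l with
  | nil => exact ((Derives.of_lprov .oneR).weaken hΓ).of_eq (add_zero _)
  | cons α l ih =>
    refine (Derives.contract (Γ := 0) hΓ (Derives.of_eq ((hl α (by simp)).tensorR
      (ih fun β hβ => hl β (by simp [hβ]))) (add_zero _).symm)).of_eq (add_zero _)

theorem mem_map_toList {P : Program L U} {α : LForm L U} :
    α ∈ P.toList.map Rule.toL ↔ ∃ R ∈ P, α = R.toL := by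
  simp [eq_comm]

theorem banged_of_mem_rules {P : Program L U} :
    ∀ α ∈ P.toList.map Rule.toL, α.Banged := fun α hα =>
  (isTheory_rules P).banged α (mem_map_toList.1 hα)

theorem programL_banged (P : Program L U) : (programL P).Banged :=
  banged_foldr_tensor banged_of_mem_rules

/-! ### Rules from the operational semantics -/

/-- The guard alone entails `0`, which absorbs the heads and proves anything. -/
theorem Rule.derives_matrix_of_unsatisfiable {CT : ConstraintTheory L} {Θ : Set (LForm L U)}
    (hΘ : IsTheory Θ) (hCT : theoryL U CT ⊆ Θ) (R : Rule L U)
    (h : Models CT (.imp (IForm.exs (BCon.and R.G .top).vars (BCon.and R.G .top).toForm) .bot)) :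
    Derives Θ 0 R.matrix := by
  have h₁ : Derives Θ 0 _ := (Derives.of_iprov hΘ hCT h).bangE
  rw [IForm.star_exs] at h₁
  have hG : Derives Θ {R.G.toGoal.toL} (.exs (BCon.and R.G .top).vars
      (BCon.and R.G .top).toForm.star) := by
    refine .exsR _ ?_
    rw [BCon.star_toForm]
    exact ((Derives.identity _).tensorR (.of_lprov .oneR)).of_eq (add_zero _)
  have h₂ : Derives Θ {R.G.toGoal.toL} .zero := (h₁.lolliE hG).of_eq (zero_add _)
  refine .lolliR (.tensorL ?_)
  exact (h₂.cut (Γ' := {.tensor R.H₁.toGoal.toL R.H₂.toGoal.toL}) Derives.zeroL).of_eq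
    (add_comm _ _)

theorem Rule.derives_matrix_of_computable {CT : ConstraintTheory L} (hEq : HasEquality CT)
    {Θ : Set (LForm L U)} (hΘ : IsTheory Θ) (hCT : theoryL U CT ⊆ Θ) {P : Program L U}
    (hP : ∀ R ∈ P, R.toL ∈ Θ) (R : Rule L U)
    (h : Config.cls CT
        [⟨.and (.and (.and R.H₁.toGoal R.G.toGoal) R.B) .top, (R.headVars : Set ℕ)⟩] ∈
      computable CT P
        ⟨.and (.and (.and R.H₁.toGoal R.H₂.toGoal) R.G.toGoal) .top, (R.headVars : Set ℕ)⟩) :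
    Derives Θ 0 R.matrix := by
  have h₁ := computable_derives hEq hΘ hCT hP h
  refine .lolliR ?_
  have h₂ : Derives Θ {.tensor (.tensor R.H₁.toGoal.toL R.H₂.toGoal.toL) R.G.toGoal.toL}
      (State.toL ⟨.and (.and (.and R.H₁.toGoal R.H₂.toGoal) R.G.toGoal) .top,
        (R.headVars : Set ℕ)⟩) :=
    .stateR _ (((Derives.identity _).tensorR (.of_lprov .oneR)).of_eq (add_zero _))
  -- The one-state configuration reads as the state `⊕ 0`, which accounts for the second branch.
  refine (h₂.trans h₁).trans (.plusL hΘ (Γ := 0) ?_ .zeroL)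
  -- Opening the final state exposes `H₁`, `G`, `B` and a neutral `1`; the local variables are then
  -- requantified around `B ⊗ G` only.
  refine .stateL hΘ R.matrix_right_supportedOn (.tensorL (Γ := 0) (.of_eq (.oneL ?_)
    (Multiset.cons_swap _ _ _)))
  refine .tensorL (.tensorL ?_)
  refine ((Derives.identity R.H₁.toGoal.toL).tensorR (.exsR _
    ((Derives.identity R.B.toL).tensorR (.identity R.G.toGoal.toL)))).of_eq ?_
  simp only [← Multiset.singleton_add]
  abel

theorem derives_programL {CT : ConstraintTheory L} (hEq : HasEquality CT)
    (hComplete : IsCompleteTheory CT) {P₁ P₂ : Program L U}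
    (h : OperationallyCEquivalent CT P₁ P₂) :
    Derives (theoryL U CT) 0 (.lolli (programL P₁) (programL P₂)) := by
  refine .lolliR (.foldr_tensor (by simpa using programL_banged P₁) fun α hα => ?_)
  obtain ⟨R, hR, rfl⟩ := mem_map_toList.1 hα
  refine .of_union (programL_banged P₁) (Θ' := {α | ∃ R ∈ P₁, α = Rule.toL R})
    (fun θ hθ => .of_mem_foldr_tensor banged_of_mem_rules (mem_map_toList.2 hθ)) ?_
  have hΘ := (isTheory_theoryL (U := U) CT).union (isTheory_rules P₁)
  refine .promote hΘ (by simp) (.allsR hΘ (A := ∅) (by simp) (by simp) ?_)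
  -- The trailing `⊤` makes the satisfiability statement match the premise of `Step.apply` with
  -- remaining goal `⊤`.
  rcases hComplete (.and R.G .top) with hsat | hunsat
  · refine R.derives_matrix_of_computable hEq hΘ Set.subset_union_left
      (fun R hR => .inr ⟨R, hR, rfl⟩) ?_
    -- The only use of operational equivalence: membership for `P₁` is traded for membership for
    -- `P₂`, where one application of `R` itself, renamed by the identity, suffices.
    rw [h]
    refine .single (.apply R R .top R.headVars [] hR ⟨id, fun _ _ _ _ h => h, ?_⟩ ?_ hsat)
    · simp [Rule.subst, BCon.subst_var, UCon.subst_var, Goal.subst_var]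
    · exact fun y hy => ⟨by simp [Goal.vars], (Finset.mem_sdiff.1 hy).2⟩
  · exact R.derives_matrix_of_unsatisfiable hΘ Set.subset_union_left hunsat

end LogicalEquivalence

end CHR

theorem mainTheorem10 {L : FirstOrder.Language.{u, v}} {U : ℕ → Type w}
    (CT : CHR.ConstraintTheory L)
    (hEq : CHR.HasEquality CT)
    (hComplete : CHR.IsCompleteTheory CT)
    (P₁ P₂ : CHR.Program L U)
    (h : CHR.OperationallyCEquivalent CT P₁ P₂) :
    CHR.LogicallyEquivalent CT P₁ P₂ := by
  have hΘ := CHR.isTheory_theoryL (U := U) CT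
  obtain ⟨Δ₁, hΔ₁, h₁⟩ := CHR.derives_programL hEq hComplete h
  obtain ⟨Δ₂, hΔ₂, h₂⟩ := CHR.derives_programL hEq hComplete fun S => (h S).symm
  -- The rule for `&` shares its context, so each direction is weakened by the axioms of the other.
  refine ⟨Δ₁ + Δ₂, fun δ hδ => (Multiset.mem_add.1 hδ).elim (hΔ₁ δ) (hΔ₂ δ), .withR ?_ ?_⟩
  · rw [add_comm]
    simpa using h₁.weaken_banged fun δ hδ => hΘ.banged δ (hΔ₂ δ hδ)
  · simpa using h₂.weaken_banged fun δ hδ => hΘ.banged δ (hΔ₁ δ hδ)
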